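/- Let $(M,g)$ be a compact smooth Riemannian manifold without boundary, with Riemannian volume measure $dg$ and total volume $\operatorname{vol} M$. For real $q\ge 1$ and $h:M\to\mathbb R$ continuous put $$\|h\|_q=\Bigl(\frac1{\operatorname{vol}M}\int_M|h|^q\,dg\Bigr)^{1/q},\qquad \|h\|_\infty=\max_{x\in M}|h(x)|,$$ and let $\Delta u=\operatorname{div}\nabla u$ be the Laplace–Beltrami operator. Suppose that for some $\nu>1$ and some Sobolev constant $S\ge 0$ the Sobolev inequality $$\|u\|_{2\nu}\le S\,\|\nabla u\|_2+\|u\|_2\qquad(\text{where }\|\nabla u\|_2=\|\,|\nabla u|_g\,\|_2)$$ holds for all smooth $u:M\to\mathbb R$. Let $f:M\to[0,+\infty)$ be continuous, and smooth on the open set $\{f>0\}$, let $\tilde\lambda:M\to\mathbb R$ be continuous, and suppose that $$\Delta f\ge-\tilde\lambda f\quad\text{on }\{f>0\}.$$ Fix $p\in(1,\nu)$, let $p'$ be the conjugate exponent, $\frac1p+\frac1{p'}=1$, and put $\lambda=\|\tilde\lambda\|_{p'}$. Then $$\|f\|_\infty\le\exp\Bigl(\frac{S\sqrt{\lambda\nu}}{\sqrt\nu-\sqrt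 p}\Bigr)\,\|f\|_{2p}.$$ -/

import Mathlib

open scoped Manifold ContDiff

namespace RiemannianGeometry

noncomputable section

/-- Euclidean `n`-space, the model space of `n`-dimensional manifolds without boundary. -/
abbrev Model (n : ℕ) : Type := EuclideanSpace ℝ (Fin n)

/-- A smooth Riemannian metric on the smooth `n`-manifold `M`: a positive definite symmetric
bilinear form `g.inner x` on every tangent space `T_x M`, depending smoothly on `x`. -/
abbrev RiemMetric (n : ℕ) (M : Type*) [TopologicalSpace M] [ChartedSpace (Model n) M]
    [IsManifold (𝓡 n) ∞ M] : Type _ :=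
  Bundle.ContMDiffRiemannianMetric (𝓡 n) ∞ (Model n) (fun x : M => TangentSpace (𝓡 n) x)

/-- The partial derivative `∂h/∂yⁱ` on Euclidean space. -/
def pderiv {n : ℕ} (i : Fin n) (h : Model n → ℝ) (y : Model n) : ℝ :=
  fderiv ℝ h y (EuclideanSpace.single i 1)

variable {n : ℕ} {M : Type*} [TopologicalSpace M] [ChartedSpace (Model n) M]

/-- The coordinate vector `∂ᵢ` of the chart `φ` around `c`, at the point `φ⁻¹(y)`. -/
def coordVec (c : M) (i : Fin n) (y : Model n) :
    TangentSpace (𝓡 n) ((chartAt (Model n) c).symm y) :=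
  mfderiv (𝓡 n) (𝓡 n) (chartAt (Model n) c).symm y (EuclideanSpace.single i (1 : ℝ) : Model n)

/-- The `i`-th component, in the chart `φ` around `c`, of the vector field `X`, as a function of
the coordinates `y`: the `i`-th entry of `dφ(X)` at `φ⁻¹(y)`. -/
def vecCoord (c : M) (X : ∀ x : M, TangentSpace (𝓡 n) x) (i : Fin n) (y : Model n) : ℝ :=
  EuclideanSpace.proj (𝕜 := ℝ) i (mfderiv (𝓡 n) (𝓡 n) (chartAt (Model n) c)
    ((chartAt (Model n) c).symm y) (X ((chartAt (Model n) c).symm y)) : Model n)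

/-- The differential `du` at `x`, as a linear form on `T_x M`. -/
def differential (u : M → ℝ) (x : M) : TangentSpace (𝓡 n) x →ₗ[ℝ] ℝ :=
  (mfderiv (𝓡 n) 𝓘(ℝ, ℝ) u x).toLinearMap

variable [IsManifold (𝓡 n) ∞ M]

/-- The matrix `(g_{ij}(y))` of the metric in the chart around `c`. -/
def gram (g : RiemMetric n M) (c : M) (y : Model n) : Matrix (Fin n) (Fin n) ℝ :=
  Matrix.of fun i j => g.inner ((chartAt (Model n) c).symm y) (coordVec c i y) (coordVec c j y)

/-- The density `√det(g_{ij}(y))` of the Riemannian volume in the chart around `c`. -/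
def sqrtDet (g : RiemMetric n M) (c : M) (y : Model n) : ℝ :=
  Real.sqrt (gram g c y).det

/-- The Riemannian volume of the domain of the chart around `c`: the image under `φ⁻¹` of
`√det(g_{ij}) dy` on the range of `φ`. -/
def chartVolume [MeasurableSpace M] (g : RiemMetric n M) (c : M) : MeasureTheory.Measure M :=
  (((MeasureTheory.volume : MeasureTheory.Measure (Model n)).restrict
      (chartAt (Model n) c).target).withDensity
    (fun y => ENNReal.ofReal (sqrtDet g c y))).map (chartAt (Model n) c).symm

/-- The Riemannian volume measure. The local volumes agree where the chart domains overlap, so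
their supremum (in the complete lattice of measures) is the Borel measure whose restriction to the
domain of each chart is `√det(g_{ij}) dy`. -/
def vol [MeasurableSpace M] (g : RiemMetric n M) : MeasureTheory.Measure M :=
  ⨆ c : M, chartVolume g c

/-- The lowering of indices `v ↦ g(v, ·)`, from `T_x M` to its dual. -/
def flat (g : RiemMetric n M) (x : M) :
    TangentSpace (𝓡 n) x →ₗ[ℝ] Module.Dual ℝ (TangentSpace (𝓡 n) x) where
  toFun v := (g.inner x v).toLinearMap
  map_add' v w := by ext z; simp
  map_smul' a v := by ext z; simp

theorem flat_injective (g : RiemMetric n M) (x : M) : Function.Injective (flat g x) := by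
  rw [injective_iff_map_eq_zero]
  intro v hv
  by_contra h
  have h1 := g.pos x v h
  have h2 : g.inner x v v = 0 := LinearMap.congr_fun hv v
  exact h1.ne' h2

instance finiteDimensional_tangentSpace (x : M) :
    FiniteDimensional ℝ (TangentSpace (𝓡 n) x) :=
  inferInstanceAs (FiniteDimensional ℝ (Model n))

/-- The gradient `∇u`: the vector field with `g(∇u, ·) = du`. -/
def grad (g : RiemMetric n M) (u : M → ℝ) (x : M) : TangentSpace (𝓡 n) x :=
  (LinearMap.linearEquivOfInjective (flat g x) (flat_injective g x)
    Subspace.dual_finrank_eq.symm).symm (differential u x)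

/-- The defining property of the gradient. -/
theorem inner_grad (g : RiemMetric n M) (u : M → ℝ) (x : M) (v : TangentSpace (𝓡 n) x) :
    g.inner x (grad g u x) v = mfderiv (𝓡 n) 𝓘(ℝ, ℝ) u x v := by
  have h := (LinearMap.linearEquivOfInjective (flat g x) (flat_injective g x)
    Subspace.dual_finrank_eq.symm).apply_symm_apply (differential u x)
  exact LinearMap.congr_fun h v

/-- The length `|∇u|` of the gradient. -/
def gradNorm (g : RiemMetric n M) (u : M → ℝ) (x : M) : ℝ :=
  Real.sqrt (g.inner x (grad g u x) (grad g u x))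

/-- The divergence of a vector field, `div X = (√det g)⁻¹ ∑ᵢ ∂ᵢ(√det g · Xⁱ)`, evaluated at `x` in
the chart around `x` (the value does not depend on the chart). -/
def divergence (g : RiemMetric n M) (X : ∀ x : M, TangentSpace (𝓡 n) x) (x : M) : ℝ :=
  (sqrtDet g x (chartAt (Model n) x x))⁻¹ *
    ∑ i, pderiv i (fun y => sqrtDet g x y * vecCoord x X i y) (chartAt (Model n) x x)

/-- The Laplace–Beltrami operator `Δu = div ∇u` (nonpositive on closed manifolds). -/
def laplacian (g : RiemMetric n M) (u : M → ℝ) (x : M) : ℝ :=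
  divergence g (grad g u) x

/-- The normalized norm `‖h‖_q = ((vol M)⁻¹ ∫_M |h|^q)^{1/q}`. -/
def avgNorm [MeasurableSpace M] (g : RiemMetric n M) (q : ℝ) (h : M → ℝ) : ℝ :=
  (((vol g).real Set.univ)⁻¹ * ∫ x, |h x| ^ q ∂(vol g)) ^ (1 / q)

/-- The maximum norm `‖h‖_∞` (of a continuous function on a compact space). -/
def supNorm {M : Type*} (h : M → ℝ) : ℝ :=
  ⨆ x, |h x|

end

end RiemannianGeometry

/-! The proof is a Moser iteration. Formally, testing `Δf ≥ -lam f` with `f^(2k-1)`, `k ≥ 1`, and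
integrating by parts gives `∫ |∇ f^k|² ≤ k²/(2k-1) ∫ |lam| f^(2k) ≤ k Λ ‖f^k‖_{2p}²`, by Hölder and
`k² ≤ k(2k-1)`, where `Λ = ‖lam‖_{p'}` (`lpNormReal_gradNorm_le`). The Sobolev inequality and `‖·‖_2
≤ ‖·‖_{2p}` turn this into the reverse Hölder inequality `‖f^k‖_{2ν} ≤ (1 + S√(kΛ)) ‖f^k‖_{2p}`
(`lpNormReal_rpow_le_of_sobolev`). For `k = r^i`, `r = ν/p`, its `k`-th root bounds the norm of
exponent `2p r^(i+1)` by that of exponent `2p r^i`, up to a factor `exp(S√Λ r^(-i/2))`. These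
factors multiply to a convergent geometric series in the exponent, and the norms control the
supremum as `i → ∞` (`moser_iteration`).

Two points need care. Since `f` is smooth only where it is positive, the powers `t^k` and `t^(2k-1)`
are replaced by smooth `φ`, `ψ` vanishing for `t ≤ ε` with `ψ' = φ'²`
(`exists_smooth_power_cutoff`); then `|∇(φ∘f)|² = d(ψ∘f)(∇f)` exactly, and `ε → 0` at the end.

Green's formula must be derived from the chart definitions of volume and divergence
(`integral_mul_divergence`). It is proved in one chart from the Euclidean case and globalized by a
partition of unity. The chart independence of the divergence is itself deduced from the one-chart
formula, whose right side mentions no chart. -/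

open scoped Manifold ContDiff

namespace RiemannianGeometry

open Set MeasureTheory Filter Topology

/-! ### Metric, density and gradient in a chart. -/

section ChartGeometry

theorem clm_apply_eq_sum_single {n : ℕ} {F : Type*} [NormedAddCommGroup F] [NormedSpace ℝ F]
    (D : Model n →L[ℝ] F) (w : Model n) :
    D w = ∑ i, w i • D (EuclideanSpace.single i (1 : ℝ)) := by
  have hs : w = ∑ i, w i • (EuclideanSpace.single i (1 : ℝ) : Model n) := by
    ext j
    simp [Finset.sum_apply, Pi.single_apply]
  conv_lhs => rw [hs, map_sum]
  simp only [map_smul]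

theorem bilin_sum_sum {n : ℕ} {F : Type*} [NormedAddCommGroup F] [NormedSpace ℝ F]
    (B : F →L[ℝ] F →L[ℝ] ℝ) (a b : Fin n → ℝ) (v w : Fin n → F) :
    B (∑ i, a i • v i) (∑ j, b j • w j) = ∑ i, ∑ j, a i * b j * B (v i) (w j) := by
  simp only [map_sum, map_smul, sum_apply, smul_apply, smul_eq_mul, Finset.mul_sum]
  exact Finset.sum_comm.trans
    (Finset.sum_congr rfl fun i _ => Finset.sum_congr rfl fun j _ => by ring)

variable {n : ℕ} {M : Type*} [TopologicalSpace M] [ChartedSpace (Model n) M]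

theorem contDiffOn_comp_chart_symm {r : ℕ∞} {u : M → ℝ} {U : Set M}
    [IsManifold (𝓡 n) ∞ M]
    (hu : ContMDiffOn (𝓡 n) 𝓘(ℝ, ℝ) r u U) (c : M) :
    ContDiffOn ℝ r (u ∘ (chartAt (Model n) c).symm)
      ((chartAt (Model n) c).target ∩ (chartAt (Model n) c).symm ⁻¹' U) := by
  rw [← contMDiffOn_iff_contDiffOn]
  exact hu.comp ((((contMDiffOn_chart_symm (I := 𝓡 n) (n := ∞) (x := c))).of_le
    (by exact_mod_cast le_top)).mono inter_subset_left) (fun y hy => hy.2)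

variable [IsManifold (𝓡 n) ∞ M]

theorem isManifold_one : IsManifold (𝓡 n) 1 M :=
  IsManifold.of_le (n := ∞) (by exact_mod_cast le_top)

theorem mdifferentiable_chartAt (c : M) :
    (chartAt (Model n) c).MDifferentiable (𝓡 n) (𝓡 n) := by
  have : IsManifold (𝓡 n) 1 M := isManifold_one
  exact mdifferentiable_chart c

/-- The section is the tangent map of the inverse chart applied to a constant vector field. -/
theorem contMDiffOn_coordVec (c : M) (i : Fin n) :
    ContMDiffOn (𝓡 n) (𝓡 n).tangent ∞
      (fun y => (⟨(chartAt (Model n) c).symm y, coordVec c i y⟩ : TangentBundle (𝓡 n) M))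
      (chartAt (Model n) c).target := by
  have : IsManifold (𝓡 n) 1 M := isManifold_one
  have h1 : ContMDiffOn (𝓡 n) (𝓡 n) ∞ (chartAt (Model n) c).symm (chartAt (Model n) c).target :=
    contMDiffOn_chart_symm
  have h2 := h1.contMDiffOn_tangentMapWithin (m := ∞) le_rfl
    (chartAt (Model n) c).open_target.uniqueMDiffOn
  have h3 : ContMDiff (𝓡 n) (𝓡 n).tangent ∞
      (fun y : Model n => (⟨y, (EuclideanSpace.single i (1 : ℝ) : Model n)⟩ :
        TangentBundle (𝓡 n) (Model n))) := by
    have := (contMDiff_vectorSpace_iff_contDiff (𝕜 := ℝ) (E := Model n) (n := ∞)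
      (V := fun _ => (EuclideanSpace.single i (1 : ℝ) : Model n))).2 contDiff_const
    exact this
  have h4 := h2.comp (h3.contMDiffOn (s := (chartAt (Model n) c).target)) (fun y hy => hy)
  refine h4.congr fun y hy => ?_
  simp only [Function.comp, tangentMapWithin, coordVec]
  rw [mfderivWithin_of_isOpen (chartAt (Model n) c).open_target hy]

theorem contDiffOn_gram (g : RiemMetric n M) (c : M) (i j : Fin n) :
    ContDiffOn ℝ ∞ (fun y => gram g c y i j) (chartAt (Model n) c).target := by
  rw [← contMDiffOn_iff_contDiffOn]
  intro y hy
  have h1 : ContMDiffWithinAt (𝓡 n) (𝓡 n) ∞ (chartAt (Model n) c).symm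
      (chartAt (Model n) c).target y := contMDiffOn_chart_symm y hy
  have : ContMDiffWithinAt (𝓡 n) ((𝓡 n).prod 𝓘(ℝ)) ∞
      (fun y ↦ Bundle.TotalSpace.mk' ℝ (E := Bundle.Trivial M ℝ) ((chartAt (Model n) c).symm y)
        (g.inner _ (coordVec c i y) (coordVec c j y))) (chartAt (Model n) c).target y := by
    apply ContMDiffWithinAt.clm_bundle_apply₂ (F₁ := Model n) (F₂ := Model n)
    · exact ContMDiffAt.comp_contMDiffWithinAt y g.contMDiff.contMDiffAt h1
    · exact contMDiffOn_coordVec c i y hy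
    · exact contMDiffOn_coordVec c j y hy
  simp only [Bundle.contMDiffWithinAt_totalSpace] at this
  exact this.2

theorem coordVec_vecCoord_sum (c : M) (X : ∀ x : M, TangentSpace (𝓡 n) x) {y : Model n}
    (hy : y ∈ (chartAt (Model n) c).target) :
    X ((chartAt (Model n) c).symm y) = ∑ i, vecCoord c X i y • coordVec c i y := by
  have h := (mdifferentiable_chartAt (n := n) c).symm_comp_deriv
    ((chartAt (Model n) c).map_target hy)
  have h' := DFunLike.congr_fun h (X ((chartAt (Model n) c).symm y))
  simp only [ContinuousLinearMap.coe_comp, Function.comp_apply] at h'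
  change _ = X ((chartAt (Model n) c).symm y) at h'
  rw [(chartAt (Model n) c).right_inv hy] at h'
  let D : Model n →L[ℝ] Model n := mfderiv (𝓡 n) (𝓡 n) (chartAt (Model n) c).symm y
  let w : Model n := mfderiv (𝓡 n) (𝓡 n) (chartAt (Model n) c)
    ((chartAt (Model n) c).symm y) (X ((chartAt (Model n) c).symm y))
  exact h'.symm.trans (clm_apply_eq_sum_single D w)

theorem linearIndependent_coordVec (c : M) {y : Model n} (hy : y ∈ (chartAt (Model n) c).target)
    (a : Fin n → ℝ) (ha : ∑ i, a i • coordVec c i y = 0) : a = 0 := by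
  have h := (mdifferentiable_chartAt (n := n) c).comp_symm_deriv hy
  have h' := congrArg (mfderiv (𝓡 n) (𝓡 n) (chartAt (Model n) c) ((chartAt (Model n) c).symm y)) ha
  rw [map_sum, map_zero] at h'
  have h3 : ∀ i, mfderiv (𝓡 n) (𝓡 n) (chartAt (Model n) c) ((chartAt (Model n) c).symm y)
      (a i • coordVec c i y) = a i • (EuclideanSpace.single i (1 : ℝ) : Model n) := by
    intro i
    rw [map_smul]
    congr 1
    exact DFunLike.congr_fun h (EuclideanSpace.single i (1 : ℝ) : Model n)
  rw [Finset.sum_congr rfl fun i _ => h3 i] at h'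
  funext j
  have h4 : (∑ i, a i • (EuclideanSpace.single i (1 : ℝ) : Model n)) j = (0 : Model n) j :=
    congrArg (fun w : Model n => w j) h'
  simpa [Finset.sum_apply, Pi.single_apply] using h4

theorem gram_posDef (g : RiemMetric n M) (c : M) {y : Model n}
    (hy : y ∈ (chartAt (Model n) c).target) : (gram g c y).PosDef := by
  refine Matrix.PosDef.of_dotProduct_mulVec_pos ?_ fun a ha => ?_
  · ext i j
    simp [gram, g.symm _ (coordVec c i y)]
  · have h := g.pos ((chartAt (Model n) c).symm y) (∑ i, a i • coordVec c i y)
      (fun h => ha (linearIndependent_coordVec c hy a h))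
    have h2 : g.inner ((chartAt (Model n) c).symm y) (∑ i, a i • coordVec c i y)
        (∑ i, a i • coordVec c i y) = ∑ i, ∑ j, a i * a j * gram g c y i j :=
      bilin_sum_sum (F := Model n) (g.inner ((chartAt (Model n) c).symm y)) a a
        (fun i => coordVec c i y) (fun i => coordVec c i y)
    refine lt_of_lt_of_eq h (h2.trans ?_)
    simp only [dotProduct, Matrix.mulVec, Finset.mul_sum, Pi.star_apply,
      star_trivial]
    exact Finset.sum_congr rfl fun i _ => Finset.sum_congr rfl fun j _ => by ring

theorem det_gram_pos (g : RiemMetric n M) (c : M) {y : Model n}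
    (hy : y ∈ (chartAt (Model n) c).target) : 0 < (gram g c y).det :=
  (gram_posDef g c hy).det_pos

theorem sqrtDet_pos (g : RiemMetric n M) (c : M) {y : Model n}
    (hy : y ∈ (chartAt (Model n) c).target) : 0 < sqrtDet g c y :=
  Real.sqrt_pos.2 (det_gram_pos g c hy)

theorem contDiffOn_matrix_det {k : ℕ} {A : Model n → Matrix (Fin k) (Fin k) ℝ} {s : Set (Model n)}
    (hA : ∀ i j, ContDiffOn ℝ ∞ (fun y => A y i j) s) : ContDiffOn ℝ ∞ (fun y => (A y).det) s := by
  simp only [Matrix.det_apply]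
  exact ContDiffOn.sum fun σ _ => (contDiffOn_prod fun i _ => hA _ _).const_smul _

theorem contDiffOn_sqrtDet (g : RiemMetric n M) (c : M) :
    ContDiffOn ℝ ∞ (sqrtDet g c) (chartAt (Model n) c).target := by
  refine (contDiffOn_matrix_det (contDiffOn_gram g c)).sqrt fun y hy => (det_gram_pos g c hy).ne'

/-- Cramer's rule: each entry is the inverse determinant times a determinant with one row replaced
by a constant one. -/
theorem contDiffOn_gram_inv (g : RiemMetric n M) (c : M) (i j : Fin n) :
    ContDiffOn ℝ ∞ (fun y => (gram g c y)⁻¹ i j) (chartAt (Model n) c).target := by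
  simp only [Matrix.inv_def, Ring.inverse_eq_inv', Matrix.smul_apply, smul_eq_mul,
    Matrix.adjugate_apply]
  refine ((contDiffOn_matrix_det (contDiffOn_gram g c)).inv
    fun y hy => (det_gram_pos g c hy).ne').mul (contDiffOn_matrix_det fun k l => ?_)
  simp only [Matrix.updateRow_apply]
  by_cases h : k = j
  · simp only [h, if_true]; exact contDiffOn_const
  · simp only [h, if_false]; exact contDiffOn_gram g c k l

theorem mfderiv_coordVec (c : M) {u : M → ℝ} {y : Model n}
    (hy : y ∈ (chartAt (Model n) c).target)
    (hu : MDifferentiableAt (𝓡 n) 𝓘(ℝ, ℝ) u ((chartAt (Model n) c).symm y)) (i : Fin n) :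
    mfderiv (𝓡 n) 𝓘(ℝ, ℝ) u ((chartAt (Model n) c).symm y) (coordVec c i y) =
      pderiv i (u ∘ (chartAt (Model n) c).symm) y := by
  rw [pderiv, ← mfderiv_eq_fderiv, mfderiv_comp y hu
    ((mdifferentiable_chartAt (n := n) c).mdifferentiableAt_symm hy)]
  rfl

/-- Pairing `∇u` with the coordinate vectors gives the linear system `∑ᵢ g_{ji} (∇u)ⁱ = ∂ⱼu`, solved
by the inverse Gram matrix. -/
theorem vecCoord_grad (g : RiemMetric n M) (c : M) {u : M → ℝ} {y : Model n}
    (hy : y ∈ (chartAt (Model n) c).target)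
    (hu : MDifferentiableAt (𝓡 n) 𝓘(ℝ, ℝ) u ((chartAt (Model n) c).symm y)) (i : Fin n) :
    vecCoord c (grad g u) i y =
      ∑ j, (gram g c y)⁻¹ i j * pderiv j (u ∘ (chartAt (Model n) c).symm) y := by
  have h : (gram g c y).mulVec (fun i => vecCoord c (grad g u) i y) =
      fun j => pderiv j (u ∘ (chartAt (Model n) c).symm) y := by
    funext j
    rw [← mfderiv_coordVec c hy hu, ← inner_grad g, coordVec_vecCoord_sum c (grad g u) hy, g.symm]
    have h2 : ∀ b : Fin n → ℝ, g.inner ((chartAt (Model n) c).symm y) (coordVec c j y)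
        (∑ i, b i • coordVec c i y) = ∑ i, b i * gram g c y j i := by
      intro b
      rw [map_sum]
      exact Finset.sum_congr rfl fun i _ => by rw [map_smul]; rfl
    rw [h2]
    simp only [dotProduct, Matrix.mulVec]
    exact Finset.sum_congr rfl fun i _ => by ring
  have hdet : IsUnit (gram g c y).det := (det_gram_pos g c hy).ne'.isUnit
  have h2 := congrArg (fun v => (gram g c y)⁻¹.mulVec v i) h
  simp only [Matrix.mulVec_mulVec, Matrix.nonsing_inv_mul _ hdet, Matrix.one_mulVec] at h2
  rw [h2]
  rfl

theorem contDiffOn_pderiv {h : Model n → ℝ} {s : Set (Model n)} (hs : IsOpen s)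
    (hh : ContDiffOn ℝ ∞ h s) (i : Fin n) : ContDiffOn ℝ ∞ (pderiv i h) s :=
  (hh.fderiv_of_isOpen hs (m := ∞) le_rfl).clm_apply contDiffOn_const

theorem contDiffOn_vecCoord_grad (g : RiemMetric n M) (c : M) {u : M → ℝ} {U : Set M}
    (hU : IsOpen U) (hu : ContMDiffOn (𝓡 n) 𝓘(ℝ, ℝ) ∞ u U) (i : Fin n) :
    ContDiffOn ℝ ∞ (vecCoord c (grad g u) i)
      ((chartAt (Model n) c).target ∩ (chartAt (Model n) c).symm ⁻¹' U) := by
  have ho : IsOpen ((chartAt (Model n) c).target ∩ (chartAt (Model n) c).symm ⁻¹' U) :=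
    (chartAt (Model n) c).isOpen_inter_preimage_symm hU
  have h : ContDiffOn ℝ ∞ (fun y => ∑ j, (gram g c y)⁻¹ i j *
      pderiv j (u ∘ (chartAt (Model n) c).symm) y)
      ((chartAt (Model n) c).target ∩ (chartAt (Model n) c).symm ⁻¹' U) :=
    ContDiffOn.sum fun j _ => ((contDiffOn_gram_inv g c i j).mono inter_subset_left).mul
      (contDiffOn_pderiv ho (contDiffOn_comp_chart_symm (r := ⊤) hu c) j)
  refine h.congr fun y hy => vecCoord_grad g c hy.1 ?_ i
  exact ((hu _ hy.2).contMDiffAt (hU.mem_nhds hy.2)).mdifferentiableAt (by simp)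

/-- With `J` the Jacobian matrix of the transition map, the Gram matrices satisfy `G = Jᵀ G' J`;
take determinants and square roots. -/
theorem sqrtDet_chart_change (g : RiemMetric n M) (c c' : M) {y : Model n}
    (hy : y ∈ (chartAt (Model n) c).target)
    (hy' : (chartAt (Model n) c).symm y ∈ (chartAt (Model n) c').source) :
    sqrtDet g c y =
      |(fderiv ℝ (chartAt (Model n) c' ∘ (chartAt (Model n) c).symm) y).det| *
        sqrtDet g c' (chartAt (Model n) c' ((chartAt (Model n) c).symm y)) := by
  set T := chartAt (Model n) c' ∘ (chartAt (Model n) c).symm with hT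
  set L := fderiv ℝ T y with hL
  set J : Matrix (Fin n) (Fin n) ℝ := Matrix.of fun k i =>
    (L (EuclideanSpace.single i 1)) k with hJ
  have hTy : T y ∈ (chartAt (Model n) c').target := (chartAt (Model n) c').map_source hy'
  have hinv : (chartAt (Model n) c').symm (T y) = (chartAt (Model n) c).symm y :=
    (chartAt (Model n) c').left_inv hy'
  have hdet : L.det = J.det := by
    rw [ContinuousLinearMap.det,
      ← LinearMap.det_toMatrix (EuclideanSpace.basisFun (Fin n) ℝ).toBasis]
    congr 1
  have hL' : (mfderiv (𝓡 n) (𝓡 n) (chartAt (Model n) c).symm y : Model n →L[ℝ] Model n) =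
      (mfderiv (𝓡 n) (𝓡 n) (chartAt (Model n) c').symm (T y) : Model n →L[ℝ] Model n).comp L := by
    have hT' : MDifferentiableAt (𝓡 n) (𝓡 n) T y :=
      MDifferentiableAt.comp y ((mdifferentiable_chartAt (n := n) c').mdifferentiableAt hy')
        ((mdifferentiable_chartAt (n := n) c).mdifferentiableAt_symm hy)
    have h1 := mfderiv_comp y ((mdifferentiable_chartAt (n := n) c').mdifferentiableAt_symm hTy) hT'
    have h2 : (chartAt (Model n) c).symm =ᶠ[𝓝 y] (chartAt (Model n) c').symm ∘ T := by
      have ho := (chartAt (Model n) c).isOpen_inter_preimage_symm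
        (chartAt (Model n) c').open_source
      filter_upwards [ho.mem_nhds ⟨hy, hy'⟩] with z hz
      exact ((chartAt (Model n) c').left_inv hz.2).symm
    rw [hL, ← mfderiv_eq_fderiv]
    exact h2.mfderiv_eq.trans h1
  have hcomp : ∀ i, (coordVec c i y : Model n) =
      ∑ k, J k i • (coordVec c' k (T y) : Model n) := by
    intro i
    let D : Model n →L[ℝ] Model n := mfderiv (𝓡 n) (𝓡 n) (chartAt (Model n) c').symm (T y)
    have h1 : (coordVec c i y : Model n) = D (L (EuclideanSpace.single i (1 : ℝ))) :=
      DFunLike.congr_fun hL' (EuclideanSpace.single i (1 : ℝ) : Model n)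
    exact h1.trans (clm_apply_eq_sum_single D (L (EuclideanSpace.single i 1)))
  have hgram : gram g c y = J.transpose * gram g c' (T y) * J := by
    ext i j
    let B : M → Model n →L[ℝ] Model n →L[ℝ] ℝ := fun x => g.inner x
    have e1 : gram g c y i j = B ((chartAt (Model n) c').symm (T y)) (coordVec c i y : Model n)
        (coordVec c j y : Model n) := by rw [hinv]; rfl
    have e2 : ∀ k l, gram g c' (T y) k l = B ((chartAt (Model n) c').symm (T y))
        (coordVec c' k (T y) : Model n) (coordVec c' l (T y) : Model n) := fun k l => rfl
    rw [e1, hcomp i, hcomp j]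
    refine (bilin_sum_sum _ _ _ _ _).trans ?_
    simp only [Matrix.mul_apply, Matrix.transpose_apply, e2, Finset.sum_mul]
    rw [Finset.sum_comm]
    exact Finset.sum_congr rfl fun k _ => Finset.sum_congr rfl fun l _ => by ring
  rw [sqrtDet, sqrtDet, hgram, Matrix.det_mul, Matrix.det_mul, Matrix.det_transpose, hdet,
    ← Real.sqrt_sq_eq_abs, ← Real.sqrt_mul (sq_nonneg _)]
  congr 1
  change _ = J.det ^ 2 * (gram g c' (T y)).det
  ring

end ChartGeometry

/-! ### The Riemannian volume measure. -/

section Volume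

variable {n : ℕ} {M : Type*} [TopologicalSpace M] [ChartedSpace (Model n) M]

theorem aemeasurable_chart_symm [MeasurableSpace M] [BorelSpace M] (c : M)
    (μ : Measure (Model n)) :
    AEMeasurable (chartAt (Model n) c).symm (μ.restrict (chartAt (Model n) c).target) :=
  (chartAt (Model n) c).continuousOn_symm.aemeasurable (chartAt (Model n) c).open_target.measurableSet

/-- The inverse chart is continuous only on its target, so the preimage is taken in the subtype and
pushed back. -/
theorem measurableSet_target_inter_preimage [MeasurableSpace M] [BorelSpace M] (c : M)
    {s : Set M} (hs : MeasurableSet s) :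
    MeasurableSet ((chartAt (Model n) c).target ∩ (chartAt (Model n) c).symm ⁻¹' s) := by
  have h1 : Measurable ((chartAt (Model n) c).target.domRestrict (chartAt (Model n) c).symm) :=
    (continuousOn_iff_continuous_domRestrict.1 (chartAt (Model n) c).continuousOn_symm).measurable
  have h2 := (chartAt (Model n) c).open_target.measurableSet.subtype_image (h1 hs)
  convert h2 using 1
  ext y
  simp [domRestrict_apply, and_comm]

variable [IsManifold (𝓡 n) ∞ M]

theorem aemeasurable_sqrtDet (g : RiemMetric n M) (c : M) (μ : Measure (Model n)) :
    AEMeasurable (fun y => ENNReal.ofReal (sqrtDet g c y))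
      (μ.restrict (chartAt (Model n) c).target) :=
  ((contDiffOn_sqrtDet g c).continuousOn.aemeasurable
    (chartAt (Model n) c).open_target.measurableSet).ennreal_ofReal

theorem sqrtDet_nonneg (g : RiemMetric n M) (c : M) (y : Model n) : 0 ≤ sqrtDet g c y :=
  Real.sqrt_nonneg _

variable [MeasurableSpace M] [BorelSpace M]

theorem chartVolume_apply (g : RiemMetric n M) (c : M) {s : Set M} (hs : MeasurableSet s) :
    chartVolume g c s = ∫⁻ y in (chartAt (Model n) c).target ∩ (chartAt (Model n) c).symm ⁻¹' s,
      ENNReal.ofReal (sqrtDet g c y) := by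
  rw [chartVolume, Measure.map_apply_of_aemeasurable
    ((aemeasurable_chart_symm c _).mono_ac (withDensity_absolutelyContinuous _ _)) hs,
    withDensity_apply', Measure.restrict_restrict' (chartAt (Model n) c).open_target.measurableSet,
    inter_comm]

theorem chartVolume_inter_source (g : RiemMetric n M) (c : M) {s : Set M} (hs : MeasurableSet s) :
    chartVolume g c (s ∩ (chartAt (Model n) c).source) = chartVolume g c s := by
  rw [chartVolume_apply g c hs,
    chartVolume_apply g c (hs.inter (chartAt (Model n) c).open_source.measurableSet)]
  congr 2
  ext y
  constructor
  · exact fun h => ⟨h.1, h.2.1⟩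
  · exact fun h => ⟨h.1, h.2, (chartAt (Model n) c).map_target h.1⟩

/-- The change of variables formula for the transition map, whose Jacobian is the ratio of the two
densities. -/
theorem chartVolume_eq_of_subset (g : RiemMetric n M) (c c' : M) {s : Set M}
    (hs : MeasurableSet s) (hc : s ⊆ (chartAt (Model n) c).source)
    (hc' : s ⊆ (chartAt (Model n) c').source) : chartVolume g c s = chartVolume g c' s := by
  rw [chartVolume_apply g c hs, chartVolume_apply g c' hs]
  set A := (chartAt (Model n) c).target ∩ (chartAt (Model n) c).symm ⁻¹' s
  set T := chartAt (Model n) c' ∘ (chartAt (Model n) c).symm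
  have himg : (chartAt (Model n) c').target ∩ (chartAt (Model n) c').symm ⁻¹' s = T '' A := by
    ext z
    constructor
    · rintro ⟨hz, hzs⟩
      refine ⟨chartAt (Model n) c ((chartAt (Model n) c').symm z),
        ⟨(chartAt (Model n) c).map_source (hc hzs), ?_⟩, ?_⟩
      · rw [mem_preimage, (chartAt (Model n) c).left_inv (hc hzs)]; exact hzs
      · simp only [T, Function.comp]
        rw [(chartAt (Model n) c).left_inv (hc hzs), (chartAt (Model n) c').right_inv hz]
    · rintro ⟨y, ⟨hy, hys⟩, rfl⟩
      refine ⟨(chartAt (Model n) c').map_source (hc' hys), ?_⟩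
      simp only [T, Function.comp, mem_preimage]
      rw [(chartAt (Model n) c').left_inv (hc' hys)]; exact hys
  have hinj : InjOn T A := by
    intro y hy z hz h
    exact (chartAt (Model n) c).symm.injOn hy.1 hz.1
      ((chartAt (Model n) c').injOn (hc' hy.2) (hc' hz.2) h)
  have hder : ∀ y ∈ A, HasFDerivWithinAt T (fderiv ℝ T y) A y := by
    intro y hy
    have : MDifferentiableAt (𝓡 n) (𝓡 n) T y :=
      MDifferentiableAt.comp y ((mdifferentiable_chartAt (n := n) c').mdifferentiableAt (hc' hy.2))
        ((mdifferentiable_chartAt (n := n) c).mdifferentiableAt_symm hy.1)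
    exact this.differentiableAt.hasFDerivAt.hasFDerivWithinAt
  have hA : MeasurableSet A := measurableSet_target_inter_preimage c hs
  rw [himg, lintegral_image_eq_lintegral_abs_det_fderiv_mul volume hA hder hinj]
  refine setLIntegral_congr_fun hA fun y hy => ?_
  beta_reduce
  rw [sqrtDet_chart_change g c c' hy.1 (hc' hy.2), ENNReal.ofReal_mul (abs_nonneg _)]
  rfl

/-- A supremum of measures is not computed set by set, so the upper bound needs a measure dominating
every chart volume. The measure `ρ` below adds infinite mass at each point outside the chart domain:
sets leaving the domain cause no trouble, and inside it the chart volumes agree. -/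
theorem vol_apply_of_subset_source [T2Space M] (g : RiemMetric n M) (c : M) {s : Set M}
    (hs : MeasurableSet s) (hc : s ⊆ (chartAt (Model n) c).source) :
    vol g s = chartVolume g c s := by
  refine le_antisymm ?_ (le_iSup (chartVolume g) c s)
  set O := (chartAt (Model n) c).source
  have hO : MeasurableSet O := (chartAt (Model n) c).open_source.measurableSet
  let ρ : Measure M := chartVolume g c + (⊤ : ENNReal) • (Measure.count.restrict Oᶜ)
  have hle : vol g ≤ ρ := by
    refine iSup_le fun c' => Measure.le_iff.2 fun t ht => ?_
    by_cases hne : (t ∩ Oᶜ).Nonempty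
    · have : ρ t = ⊤ := by
        simp only [ρ, Measure.add_apply, Measure.smul_apply, smul_eq_mul,
          Measure.restrict_apply ht]
        rw [ENNReal.top_mul, add_top]
        rw [Ne, Measure.count_eq_zero_iff]
        exact hne.ne_empty
      rw [this]; exact le_top
    · have htO : t ⊆ O := fun x hx => by
        by_contra h
        exact hne ⟨x, hx, h⟩
      have hO' := (chartAt (Model n) c').open_source.measurableSet
      rw [← chartVolume_inter_source g c' ht, chartVolume_eq_of_subset g c' c (ht.inter hO')
        inter_subset_right (inter_subset_left.trans htO)]
      exact (measure_mono inter_subset_left).trans (Measure.le_add_right le_rfl t)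
  refine (hle s).trans ?_
  have : s ∩ Oᶜ = ∅ := by
    rw [← disjoint_iff_inter_eq_empty]; exact disjoint_compl_right.mono_left hc
  simp [ρ, Measure.restrict_apply hs, this]

theorem vol_restrict_source [T2Space M] (g : RiemMetric n M) (c : M) :
    (vol g).restrict (chartAt (Model n) c).source = chartVolume g c := by
  ext s hs
  rw [Measure.restrict_apply hs, vol_apply_of_subset_source g c
    (hs.inter (chartAt (Model n) c).open_source.measurableSet) inter_subset_right,
    chartVolume_inter_source g c hs]

theorem isLocallyFiniteMeasure_vol [T2Space M] (g : RiemMetric n M) :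
    IsLocallyFiniteMeasure (vol g) := by
  refine ⟨fun x => ?_⟩
  have hx := mem_chart_source (Model n) x
  obtain ⟨K, hK, hKt, hKc⟩ := local_compact_nhds
    ((chartAt (Model n) x).open_target.mem_nhds (mem_chart_target (Model n) x))
  have ho : IsOpen ((chartAt (Model n) x).source ∩ chartAt (Model n) x ⁻¹' interior K) :=
    (chartAt (Model n) x).isOpen_inter_preimage isOpen_interior
  refine ⟨_, ho.mem_nhds ⟨hx, mem_interior_iff_mem_nhds.2 hK⟩, ?_⟩
  rw [vol_apply_of_subset_source g x ho.measurableSet inter_subset_left,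
    chartVolume_apply g x ho.measurableSet]
  obtain ⟨C, hC⟩ := hKc.exists_bound_of_continuousOn
    ((contDiffOn_sqrtDet g x).continuousOn.mono hKt)
  have hsub : (chartAt (Model n) x).target ∩ (chartAt (Model n) x).symm ⁻¹'
      ((chartAt (Model n) x).source ∩ chartAt (Model n) x ⁻¹' interior K) ⊆ K := by
    rintro y ⟨hy, -, hyK⟩
    rw [mem_preimage, (chartAt (Model n) x).right_inv hy] at hyK
    exact interior_subset hyK
  calc _ ≤ ∫⁻ y in K, ENNReal.ofReal (sqrtDet g x y) := lintegral_mono_set hsub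
    _ ≤ ∫⁻ _ in K, ENNReal.ofReal C := setLIntegral_mono' hKc.measurableSet fun y hy =>
        ENNReal.ofReal_le_ofReal ((le_abs_self _).trans (hC y hy))
    _ < ⊤ := by
      rw [setLIntegral_const]
      exact ENNReal.mul_lt_top ENNReal.ofReal_lt_top hKc.measure_lt_top

theorem isFiniteMeasure_vol [T2Space M] [CompactSpace M] (g : RiemMetric n M) :
    IsFiniteMeasure (vol g) := by
  have := isLocallyFiniteMeasure_vol g
  infer_instance

theorem isOpenPosMeasure_vol [T2Space M] (g : RiemMetric n M) :
    (vol g).IsOpenPosMeasure := by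
  refine ⟨fun U hU ⟨x, hx⟩ h0 => ?_⟩
  have ho : IsOpen (U ∩ (chartAt (Model n) x).source) :=
    hU.inter (chartAt (Model n) x).open_source
  have h1 : vol g (U ∩ (chartAt (Model n) x).source) = 0 := measure_mono_null inter_subset_left h0
  rw [vol_apply_of_subset_source g x ho.measurableSet inter_subset_right,
    chartVolume_apply g x ho.measurableSet] at h1
  set A := (chartAt (Model n) x).target ∩ (chartAt (Model n) x).symm ⁻¹'
    (U ∩ (chartAt (Model n) x).source) with hA
  have hAo : IsOpen A := (chartAt (Model n) x).isOpen_inter_preimage_symm ho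
  have hAn : A.Nonempty := ⟨chartAt (Model n) x x, mem_chart_target (Model n) x, by
    rw [mem_preimage, (chartAt (Model n) x).left_inv (mem_chart_source (Model n) x)]
    exact ⟨hx, mem_chart_source (Model n) x⟩⟩
  rw [lintegral_eq_zero_iff' ((aemeasurable_sqrtDet g x volume).mono_measure
    (Measure.restrict_mono inter_subset_left le_rfl))] at h1
  have h2 : ∀ᵐ y ∂(volume : Measure (Model n)), y ∈ A → ENNReal.ofReal (sqrtDet g x y) = 0 :=
    (ae_restrict_iff' hAo.measurableSet).1 h1
  refine (hAo.measure_pos volume hAn).ne' (measure_mono_null ?_ h2)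
  intro y hy
  simp only [mem_compl_iff, mem_ofPred_eq, not_forall]
  exact ⟨hy, (ENNReal.ofReal_pos.2 (sqrtDet_pos g x hy.1)).ne'⟩

theorem integral_vol_eq_of_eq_zero [T2Space M] (g : RiemMetric n M) (c : M) {h : M → ℝ}
    (hh : Continuous h) (h0 : ∀ x ∉ (chartAt (Model n) c).source, h x = 0) :
    ∫ x, h x ∂(vol g) = ∫ y in (chartAt (Model n) c).target,
      sqrtDet g c y * h ((chartAt (Model n) c).symm y) := by
  rw [← setIntegral_eq_integral_of_forall_compl_eq_zero h0, vol_restrict_source, chartVolume,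
    integral_map ((aemeasurable_chart_symm c _).mono_ac (withDensity_absolutelyContinuous _ _))
      hh.aestronglyMeasurable, integral_withDensity_eq_integral_toReal_smul₀
      (aemeasurable_sqrtDet g c _) (by simp)]
  refine integral_congr_ae (Eventually.of_forall fun y => ?_)
  simp only [smul_eq_mul]
  rw [ENNReal.toReal_ofReal (sqrtDet_nonneg g c y)]

end Volume

/-! ### Green's formula and chart independence of the divergence. -/

section Divergence

variable {n : ℕ} {M : Type*} [TopologicalSpace M] [ChartedSpace (Model n) M]

/-- Integration by parts against the constant function `1`. -/
theorem integral_pderiv_eq_zero {F : Model n → ℝ} (hF : ContDiff ℝ ∞ F)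
    (hc : HasCompactSupport F) (i : Fin n) : Integrable (pderiv i F) ∧ ∫ y, pderiv i F y = 0 := by
  have hd : Continuous (pderiv i F) :=
    (hF.continuous_fderiv (by simp)).clm_apply continuous_const
  have hi : Integrable (pderiv i F) :=
    hd.integrable_of_hasCompactSupport (hc.fderiv_apply ℝ _)
  refine ⟨hi, ?_⟩
  have := integral_mul_fderiv_eq_neg_fderiv_mul_of_integrable (μ := (volume : Measure (Model n)))
    (f := fun _ => (1 : ℝ)) (g := F) (v := EuclideanSpace.single i 1) (𝕜 := ℝ)
    (by simp) (by simp only [one_mul]; exact hi)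
    (by simpa using hF.continuous.integrable_of_hasCompactSupport hc)
    (by fun_prop) (fun y _ => (hF.differentiable (by simp)) y)
  simpa [pderiv] using this

/-- The derivative `du(X)` of the function `u` along the vector field `X`. -/
noncomputable def dirDeriv (u : M → ℝ) (X : ∀ x : M, TangentSpace (𝓡 n) x) (x : M) : ℝ :=
  mfderiv (𝓡 n) 𝓘(ℝ, ℝ) u x (X x)

variable {X : ∀ x : M, TangentSpace (𝓡 n) x} {U : Set M}

theorem mapsTo_chart (c : M) : MapsTo (chartAt (Model n) c) ((chartAt (Model n) c).source ∩ U)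
    ((chartAt (Model n) c).target ∩ (chartAt (Model n) c).symm ⁻¹' U) := by
  rintro x ⟨hx, hxU⟩
  refine ⟨(chartAt (Model n) c).map_source hx, ?_⟩
  rw [mem_preimage, (chartAt (Model n) c).left_inv hx]
  exact hxU

theorem dirDeriv_eq_zero_of_notMem_tsupport {η : M → ℝ} {x : M} (hx : x ∉ tsupport η) :
    dirDeriv η X x = 0 := by
  have h : η =ᶠ[𝓝 x] fun _ => (0 : ℝ) := notMem_tsupport_iff_eventuallyEq.1 hx
  have h2 : mfderiv (𝓡 n) 𝓘(ℝ, ℝ) η x = 0 := h.mfderiv_eq.trans mfderiv_const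
  rw [dirDeriv, h2]
  rfl

variable [IsManifold (𝓡 n) ∞ M]

/-- The divergence of `X` at `x`, computed in the chart around `c`. -/
noncomputable def localDiv (g : RiemMetric n M) (c : M) (X : ∀ x : M, TangentSpace (𝓡 n) x)
    (x : M) : ℝ :=
  (sqrtDet g c (chartAt (Model n) c x))⁻¹ *
    ∑ i, pderiv i (fun y => sqrtDet g c y * vecCoord c X i y) (chartAt (Model n) c x)

/-- Smoothness of a vector field on `U`, in terms of its components in all charts. -/
def SmoothCoordsOn (X : ∀ x : M, TangentSpace (𝓡 n) x) (U : Set M) : Prop :=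
  ∀ (c : M) (i : Fin n), ContDiffOn ℝ ∞ (vecCoord c X i)
    ((chartAt (Model n) c).target ∩ (chartAt (Model n) c).symm ⁻¹' U)


theorem dirDeriv_eq_sum_vecCoord (c : M) (X : ∀ x : M, TangentSpace (𝓡 n) x) {u : M → ℝ}
    {y : Model n} (hy : y ∈ (chartAt (Model n) c).target)
    (hu : MDifferentiableAt (𝓡 n) 𝓘(ℝ, ℝ) u ((chartAt (Model n) c).symm y)) :
    dirDeriv u X ((chartAt (Model n) c).symm y) =
      ∑ i, vecCoord c X i y * pderiv i (u ∘ (chartAt (Model n) c).symm) y := by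
  rw [dirDeriv, coordVec_vecCoord_sum c X hy, map_sum]
  refine Finset.sum_congr rfl fun i _ => ?_
  rw [map_smul, mfderiv_coordVec c hy hu]
  rfl

theorem contDiffOn_sqrtDet_mul_vecCoord (g : RiemMetric n M) (hX : SmoothCoordsOn X U) (c : M)
    (i : Fin n) : ContDiffOn ℝ ∞ (fun y => sqrtDet g c y * vecCoord c X i y)
      ((chartAt (Model n) c).target ∩ (chartAt (Model n) c).symm ⁻¹' U) :=
  ((contDiffOn_sqrtDet g c).mono inter_subset_left).mul (hX c i)

theorem continuousOn_localDiv (g : RiemMetric n M) (hU : IsOpen U) (hX : SmoothCoordsOn X U)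
    (c : M) : ContinuousOn (localDiv g c X) ((chartAt (Model n) c).source ∩ U) := by
  have ho : IsOpen ((chartAt (Model n) c).target ∩ (chartAt (Model n) c).symm ⁻¹' U) :=
    (chartAt (Model n) c).isOpen_inter_preimage_symm hU
  have hφ : ContinuousOn (chartAt (Model n) c) ((chartAt (Model n) c).source ∩ U) :=
    (chartAt (Model n) c).continuousOn.mono inter_subset_left
  refine ContinuousOn.mul (ContinuousOn.inv₀ ?_ ?_) (continuousOn_finsetSum _ fun i _ => ?_)
  · exact (contDiffOn_sqrtDet g c).continuousOn.comp hφ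
      fun x hx => (chartAt (Model n) c).map_source hx.1
  · exact fun x hx => (sqrtDet_pos g c ((chartAt (Model n) c).map_source hx.1)).ne'
  · exact (contDiffOn_pderiv ho (contDiffOn_sqrtDet_mul_vecCoord g hX c i) i).continuousOn.comp hφ
      (mapsTo_chart c)

theorem continuous_dirDeriv (hU : IsOpen U) (hX : SmoothCoordsOn X U) {η : M → ℝ}
    (hη : ContMDiff (𝓡 n) 𝓘(ℝ, ℝ) ∞ η) (hs : tsupport η ⊆ U) :
    Continuous (dirDeriv η X) := by
  refine continuous_iff_continuousAt.2 fun x => ?_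
  by_cases hx : x ∈ tsupport η
  · have ho : IsOpen ((chartAt (Model n) x).target ∩ (chartAt (Model n) x).symm ⁻¹' U) :=
      (chartAt (Model n) x).isOpen_inter_preimage_symm hU
    have hφ : ContinuousOn (chartAt (Model n) x) ((chartAt (Model n) x).source ∩ U) :=
      (chartAt (Model n) x).continuousOn.mono inter_subset_left
    have h1 : ContinuousOn (fun z => ∑ i, vecCoord x X i (chartAt (Model n) x z) *
        pderiv i (η ∘ (chartAt (Model n) x).symm) (chartAt (Model n) x z))
        ((chartAt (Model n) x).source ∩ U) :=
      continuousOn_finsetSum _ fun i _ => ((hX x i).continuousOn.comp hφ (mapsTo_chart x)).mul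
        ((contDiffOn_pderiv ho (contDiffOn_comp_chart_symm (r := ⊤)
          (hη.contMDiffOn (s := U)) x) i).continuousOn.comp hφ (mapsTo_chart x))
    have hn : (chartAt (Model n) x).source ∩ U ∈ 𝓝 x :=
      ((chartAt (Model n) x).open_source.inter hU).mem_nhds ⟨mem_chart_source (Model n) x, hs hx⟩
    refine (h1.continuousAt hn).congr ?_
    filter_upwards [hn] with z hz
    have := dirDeriv_eq_sum_vecCoord x X ((chartAt (Model n) x).map_source hz.1)
      ((hη _).mdifferentiableAt (by simp))
    rw [← this, (chartAt (Model n) x).left_inv hz.1]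
  · have h2 : dirDeriv η X =ᶠ[𝓝 x] fun _ => 0 := by
      filter_upwards [(isClosed_tsupport η).isOpen_compl.mem_nhds hx] with z hz
      exact dirDeriv_eq_zero_of_notMem_tsupport hz
    exact continuousAt_const.congr h2.symm

theorem continuous_mul_of_tsupport_subset {η d : M → ℝ} (hU : IsOpen U) (hη : Continuous η)
    (hs : tsupport η ⊆ U) (hd : ContinuousOn d U) : Continuous (fun x => η x * d x) := by
  refine continuous_iff_continuousAt.2 fun x => ?_
  by_cases hx : x ∈ tsupport η
  · exact hη.continuousAt.mul (hd.continuousAt (hU.mem_nhds (hs hx)))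
  · have h2 : (fun z => η z * d z) =ᶠ[𝓝 x] fun _ => 0 := by
      filter_upwards [(isClosed_tsupport η).isOpen_compl.mem_nhds hx] with z hz
      rw [image_eq_zero_of_notMem_tsupport hz, zero_mul]
    exact continuousAt_const.congr h2.symm

/-- The product rule for `∑ᵢ ∂ᵢ(η √det Xⁱ)`. Each `η √det Xⁱ`, extended by zero, is smooth on all of
Euclidean space because the chart image `K` of the support of `η` is compact and lies in the open
set `W`. -/
theorem sum_pderiv_indicator (g : RiemMetric n M) [T2Space M] [CompactSpace M] (hU : IsOpen U)
    (hX : SmoothCoordsOn X U) (c : M)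
    {η : M → ℝ} (hη : ContMDiff (𝓡 n) 𝓘(ℝ, ℝ) ∞ η)
    (hs : tsupport η ⊆ (chartAt (Model n) c).source ∩ U) :
    ∃ F : Fin n → Model n → ℝ, (∀ i, ContDiff ℝ ∞ (F i)) ∧ (∀ i, HasCompactSupport (F i)) ∧
      ∀ y, indicator (chartAt (Model n) c).target (fun y => sqrtDet g c y *
        (η ((chartAt (Model n) c).symm y) * localDiv g c X ((chartAt (Model n) c).symm y) +
        dirDeriv η X ((chartAt (Model n) c).symm y))) y = ∑ i, pderiv i (F i) y := by
  set e := chartAt (Model n) c with he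
  set W := e.target ∩ e.symm ⁻¹' U with hW
  have hWo : IsOpen W := e.isOpen_inter_preimage_symm hU
  set K := e '' tsupport η with hK
  have hKc : IsCompact K := (isClosed_tsupport η).isCompact.image_of_continuousOn
    (e.continuousOn.mono (hs.trans inter_subset_left))
  have hKW : K ⊆ W := by
    rintro _ ⟨x, hx, rfl⟩
    exact mapsTo_chart c (hs hx)
  have hnot : ∀ y ∈ e.target, y ∉ K → e.symm y ∉ tsupport η := fun y hy hyK h =>
    hyK ⟨_, h, e.right_inv hy⟩
  let G : Fin n → Model n → ℝ := fun i y => η (e.symm y) * (sqrtDet g c y * vecCoord c X i y)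
  let F : Fin n → Model n → ℝ := fun i => indicator W (G i)
  have hηs : ContDiffOn ℝ ∞ (η ∘ e.symm) W :=
    contDiffOn_comp_chart_symm (r := ⊤) (hη.contMDiffOn (s := U)) c
  have hw : ∀ i, ContDiffOn ℝ ∞ (fun y => sqrtDet g c y * vecCoord c X i y) W :=
    contDiffOn_sqrtDet_mul_vecCoord g hX c
  have hG : ∀ i, ContDiffOn ℝ ∞ (G i) W := fun i => hηs.mul (hw i)
  have hFG : ∀ i, ∀ y ∈ W, F i =ᶠ[𝓝 y] G i := fun i y hy => by
    filter_upwards [hWo.mem_nhds hy] with z hz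
    exact indicator_of_mem hz _
  have hF0' : ∀ i, ∀ y ∉ K, F i y = 0 := fun i y hy => by
    by_cases hyW : y ∈ W
    · simp only [F, indicator_of_mem hyW, G]
      rw [image_eq_zero_of_notMem_tsupport (hnot y hyW.1 hy), zero_mul]
    · exact indicator_of_notMem hyW _
  have hF0 : ∀ i, ∀ y ∉ K, F i =ᶠ[𝓝 y] fun _ => 0 := fun i y hy => by
    filter_upwards [hKc.isClosed.isOpen_compl.mem_nhds hy] with z hz
    exact hF0' i z hz
  refine ⟨F, fun i => ?_, fun i => HasCompactSupport.intro hKc (hF0' i), fun y => ?_⟩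
  · refine contDiff_iff_contDiffAt.2 fun y => ?_
    by_cases hy : y ∈ K
    · exact ((hG i).contDiffAt (hWo.mem_nhds (hKW hy))).congr_of_eventuallyEq (hFG i y (hKW hy))
    · exact contDiffAt_const.congr_of_eventuallyEq (hF0 i y hy)
  · by_cases hy : y ∈ K
    · have hyW := hKW hy
      -- The factor `√det` cancels the inverse density in `localDiv`, leaving the two halves of the
      -- product rule.
      rw [indicator_of_mem hyW.1, dirDeriv_eq_sum_vecCoord c X hyW.1
        ((hη _).mdifferentiableAt (by simp)), localDiv, ← he, e.right_inv hyW.1, mul_add,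
        mul_left_comm, mul_inv_cancel_left₀ (sqrtDet_pos g c hyW.1).ne', Finset.mul_sum,
        Finset.mul_sum, ← Finset.sum_add_distrib]
      refine Finset.sum_congr rfl fun i _ => ?_
      have d1 : DifferentiableAt ℝ (η ∘ e.symm) y :=
        (hηs.contDiffAt (hWo.mem_nhds hyW)).differentiableAt (by simp)
      have d2 : DifferentiableAt ℝ (fun y => sqrtDet g c y * vecCoord c X i y) y :=
        ((hw i).contDiffAt (hWo.mem_nhds hyW)).differentiableAt (by simp)
      have d3 : fderiv ℝ (F i) y = _ := (hFG i y hyW).fderiv_eq.trans (fderiv_mul d1 d2)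
      simp only [pderiv]
      rw [d3]
      simp only [add_apply, smul_apply, smul_eq_mul, Function.comp_def]
      ring
    · have h0 : ∀ i, pderiv i (F i) y = 0 := fun i => by
        simp only [pderiv]
        rw [(hF0 i y hy).fderiv_eq]
        simp
      rw [Finset.sum_eq_zero fun i _ => h0 i]
      by_cases hyt : y ∈ e.target
      · rw [indicator_of_mem hyt, image_eq_zero_of_notMem_tsupport (hnot y hyt hy),
          dirDeriv_eq_zero_of_notMem_tsupport (hnot y hyt hy)]
        simp
      · exact indicator_of_notMem hyt _

variable [T2Space M] [CompactSpace M] [MeasurableSpace M] [BorelSpace M]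

theorem integrable_of_continuous (g : RiemMetric n M) {h : M → ℝ} (hh : Continuous h) :
    Integrable h (vol g) := by
  have := isFiniteMeasure_vol g
  exact hh.integrable_of_hasCompactSupport (HasCompactSupport.of_compactSpace h)

theorem integral_mul_localDiv (g : RiemMetric n M) (hU : IsOpen U) (hX : SmoothCoordsOn X U)
    (c : M) {η : M → ℝ} (hη : ContMDiff (𝓡 n) 𝓘(ℝ, ℝ) ∞ η)
    (hs : tsupport η ⊆ (chartAt (Model n) c).source ∩ U) :
    ∫ x, η x * localDiv g c X x ∂(vol g) =
      -∫ x, dirDeriv η X x ∂(vol g) := by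
  have h1 : Continuous (fun x => η x * localDiv g c X x) :=
    continuous_mul_of_tsupport_subset ((chartAt (Model n) c).open_source.inter hU)
      hη.continuous hs (continuousOn_localDiv g hU hX c)
  have h2 := continuous_dirDeriv hU hX hη (hs.trans inter_subset_right)
  rw [eq_neg_iff_add_eq_zero]
  rw [← integral_add (integrable_of_continuous g h1) (integrable_of_continuous g h2)]
  obtain ⟨F, hF, hFc, hFe⟩ := sum_pderiv_indicator g hU hX c hη hs
  have h3 : Continuous (fun x => η x * localDiv g c X x + dirDeriv η X x) := h1.add h2
  rw [integral_vol_eq_of_eq_zero g c h3 fun x hx => ?_,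
    ← integral_indicator (chartAt (Model n) c).open_target.measurableSet]
  · rw [integral_congr_ae (Eventually.of_forall hFe),
      integral_finsetSum _ fun i _ => (integral_pderiv_eq_zero (hF i) (hFc i) i).1]
    exact Finset.sum_eq_zero fun i _ => (integral_pderiv_eq_zero (hF i) (hFc i) i).2
  · have hx' : x ∉ tsupport η := fun h => hx (hs h).1
    rw [image_eq_zero_of_notMem_tsupport hx', dirDeriv_eq_zero_of_notMem_tsupport hx']
    simp

/-- No transformation law is computed. Against every test function on the overlap both sides
integrate to `-∫ dη(X)`, so they agree almost everywhere, hence everywhere by continuity, as the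
volume charges open sets. -/
theorem localDiv_eq (g : RiemMetric n M) (hU : IsOpen U) (hX : SmoothCoordsOn X U)
    (c c' : M) : EqOn (localDiv g c X) (localDiv g c' X)
      ((chartAt (Model n) c).source ∩ (chartAt (Model n) c').source ∩ U) := by
  set W := (chartAt (Model n) c).source ∩ (chartAt (Model n) c').source ∩ U
  have hW : IsOpen W := ((chartAt (Model n) c).open_source.inter
    (chartAt (Model n) c').open_source).inter hU
  have := isFiniteMeasure_vol g
  have := isOpenPosMeasure_vol g
  have := ChartedSpace.secondCountable_of_sigmaCompact (Model n) M
  have hc : ContinuousOn (localDiv g c X) W :=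
    (continuousOn_localDiv g hU hX c).mono fun x hx => ⟨hx.1.1, hx.2⟩
  have hc' : ContinuousOn (localDiv g c' X) W :=
    (continuousOn_localDiv g hU hX c').mono fun x hx => ⟨hx.1.2, hx.2⟩
  have hae : ∀ᵐ x ∂(vol g), x ∈ W → (localDiv g c X - localDiv g c' X) x = 0 := by
    refine hW.ae_eq_zero_of_integral_contMDiff_smul_eq_zero (𝓡 n)
      ((hc.sub hc').locallyIntegrableOn hW.measurableSet) fun η hη _ hs => ?_
    have e1 := integral_mul_localDiv g hU hX c hη (hs.trans fun x hx => ⟨hx.1.1, hx.2⟩)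
    have e2 := integral_mul_localDiv g hU hX c' hη (hs.trans fun x hx => ⟨hx.1.2, hx.2⟩)
    have i1 := integrable_of_continuous g
      (continuous_mul_of_tsupport_subset hW hη.continuous hs hc)
    have i2 := integrable_of_continuous g
      (continuous_mul_of_tsupport_subset hW hη.continuous hs hc')
    simp only [Pi.sub_apply, smul_eq_mul, mul_sub]
    rw [integral_sub i1 i2, e1, e2, sub_self]
  refine Measure.eqOn_open_of_ae_eq (μ := vol g) ?_ hW hc hc'
  refine (ae_restrict_iff' hW.measurableSet).2 ?_
  filter_upwards [hae] with x hx hxW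
  exact sub_eq_zero.1 (hx hxW)

theorem divergence_eq_localDiv (g : RiemMetric n M) (hU : IsOpen U) (hX : SmoothCoordsOn X U)
    {c x : M} (hx : x ∈ (chartAt (Model n) c).source) (hxU : x ∈ U) :
    divergence g X x = localDiv g c X x :=
  localDiv_eq g hU hX x c ⟨⟨mem_chart_source (Model n) x, hx⟩, hxU⟩

/-- The chart in `divergence` moves with the point; near `x` it can be frozen to the chart at `x`.
-/
theorem continuousOn_divergence (g : RiemMetric n M) (hU : IsOpen U) (hX : SmoothCoordsOn X U) :
    ContinuousOn (divergence g X) U := by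
  intro x hx
  have ho := (chartAt (Model n) x).open_source.inter hU
  have hn : (chartAt (Model n) x).source ∩ U ∈ 𝓝 x :=
    ho.mem_nhds ⟨mem_chart_source (Model n) x, hx⟩
  refine ContinuousAt.continuousWithinAt
    (((continuousOn_localDiv g hU hX x).continuousAt hn).congr ?_)
  filter_upwards [hn] with z hz
  exact (divergence_eq_localDiv g hU hX hz.1 hz.2).symm

/-- A partition of unity splits `v` into pieces supported in single charts, where
`integral_mul_localDiv` applies. -/
theorem integral_mul_divergence (g : RiemMetric n M) (hU : IsOpen U) (hX : SmoothCoordsOn X U)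
    {v : M → ℝ} (hv : ContMDiff (𝓡 n) 𝓘(ℝ, ℝ) ∞ v) (hs : tsupport v ⊆ U) :
    ∫ x, v x * divergence g X x ∂(vol g) =
      -∫ x, dirDeriv v X x ∂(vol g) := by
  obtain ⟨t, ht⟩ := isCompact_univ.elim_finite_subcover
    (fun c : M => (chartAt (Model n) c).source) (fun c => (chartAt (Model n) c).open_source)
    (fun x _ => mem_iUnion.2 ⟨x, mem_chart_source (Model n) x⟩)
  let p : Fin t.card → M := fun i => t.equivFin.symm i
  obtain ⟨ρ, hρ⟩ := SmoothPartitionOfUnity.exists_isSubordinate (𝓡 n) isClosed_univ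
    (fun i => (chartAt (Model n) (p i)).source) (fun i => (chartAt (Model n) (p i)).open_source)
    (fun x hx => by
      obtain ⟨c, hc, hxc⟩ := mem_iUnion₂.1 (ht hx)
      exact mem_iUnion.2 ⟨t.equivFin ⟨c, hc⟩, by simpa [p] using hxc⟩)
  let w : Fin t.card → M → ℝ := fun c x => ρ c x * v x
  have hw : ∀ c, ContMDiff (𝓡 n) 𝓘(ℝ, ℝ) ∞ (w c) := fun c => (ρ c).contMDiff.mul hv
  have hsum : v = ∑ c, w c := by
    funext x
    have h1 := ρ.sum_eq_one (mem_univ x)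
    rw [finsum_eq_sum_of_fintype] at h1
    rw [Finset.sum_apply, ← Finset.sum_mul, h1, one_mul]
  have hws : ∀ c : Fin t.card, tsupport (w c) ⊆ (chartAt (Model n) (p c)).source ∩ U := fun c =>
    subset_inter ((tsupport_mul_subset_left).trans (hρ c)) ((tsupport_mul_subset_right).trans hs)
  have hd : ∀ (c : Fin t.card) (x : M), w c x * divergence g X x = w c x * localDiv g (p c) X x := by
    intro c x
    by_cases hx : x ∈ tsupport (w c)
    · rw [divergence_eq_localDiv g hU hX (hws c hx).1 (hws c hx).2]
    · rw [image_eq_zero_of_notMem_tsupport hx, zero_mul, zero_mul]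
  have e1 : ∀ x, v x * divergence g X x = ∑ c, w c x * localDiv g (p c) X x := fun x => by
    rw [← Finset.sum_congr rfl fun c _ => hd c x, ← Finset.sum_mul]
    congr 1
    exact (congrFun hsum x).trans (Finset.sum_apply _ _ _)
  have e2 : ∀ x, dirDeriv v X x = ∑ c, dirDeriv (w c) X x := fun x => by
    have h1 : HasMFDerivAt (𝓡 n) 𝓘(ℝ, ℝ) (∑ c, w c) x
        (∑ c, mfderiv (𝓡 n) 𝓘(ℝ, ℝ) (w c) x) :=
      HasMFDerivAt.sum fun c _ => ((hw c x).mdifferentiableAt (by simp)).hasMFDerivAt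
    rw [← hsum] at h1
    rw [dirDeriv, h1.mfderiv]
    exact sum_apply _ _ _
  rw [integral_congr_ae (Eventually.of_forall e1), integral_congr_ae (Eventually.of_forall e2),
    integral_finsetSum, integral_finsetSum, ← Finset.sum_neg_distrib]
  · exact Finset.sum_congr rfl fun c _ => integral_mul_localDiv g hU hX (p c) (hw c) (hws c)
  · exact fun c _ => integrable_of_continuous g
      (continuous_dirDeriv hU hX (hw c) ((hws c).trans inter_subset_right))
  · exact fun c _ => integrable_of_continuous g (continuous_mul_of_tsupport_subset
      ((chartAt (Model n) (p c)).open_source.inter hU) (hw c).continuous (hws c)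
      (continuousOn_localDiv g hU hX (p c)))

end Divergence

/-! ### Smooth substitutes for the powers `t^k` and `t^(2k-1)`. -/

section Cutoff

/-- A smooth function that vanishes near `0` and approximates the derivative of `t ^ k`. -/
noncomputable def cutDeriv (k ε s : ℝ) : ℝ := Real.smoothTransition (s / ε - 1) * (k * s ^ (k - 1))

variable {k ε : ℝ}

theorem cutDeriv_eq_zero (hε : 0 < ε) {s : ℝ} (hs : s ≤ ε) : cutDeriv k ε s = 0 := by
  rw [cutDeriv, Real.smoothTransition.zero_of_nonpos, zero_mul]
  rw [sub_nonpos, div_le_one hε]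
  exact hs

theorem cutDeriv_eq (hε : 0 < ε) {s : ℝ} (hs : 2 * ε ≤ s) : cutDeriv k ε s = k * s ^ (k - 1) := by
  rw [cutDeriv, Real.smoothTransition.one_of_one_le, one_mul]
  rw [le_sub_iff_add_le, le_div_iff₀ hε]
  linarith

theorem cutDeriv_nonneg (hk : 1 ≤ k) {s : ℝ} (hs : 0 ≤ s) : 0 ≤ cutDeriv k ε s :=
  mul_nonneg (Real.smoothTransition.nonneg _)
    (mul_nonneg (by linarith) (Real.rpow_nonneg hs _))

theorem cutDeriv_le (hk : 1 ≤ k) {s : ℝ} (hs : 0 ≤ s) : cutDeriv k ε s ≤ k * s ^ (k - 1) :=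
  mul_le_of_le_one_left (mul_nonneg (by linarith) (Real.rpow_nonneg hs _))
    (Real.smoothTransition.le_one _)

theorem contDiff_cutDeriv (hε : 0 < ε) : ContDiff ℝ ∞ (cutDeriv k ε) := by
  refine contDiff_iff_contDiffAt.2 fun s => ?_
  rcases lt_or_ge 0 s with hs | hs
  · have h1 : ContDiff ℝ ∞ fun s : ℝ => Real.smoothTransition (s / ε - 1) :=
      Real.smoothTransition.contDiff.comp ((contDiff_id.div_const ε).sub contDiff_const)
    exact h1.contDiffAt.mul (contDiffAt_const.mul (contDiffAt_id.rpow_const_of_ne hs.ne'))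
  · have : cutDeriv k ε =ᶠ[𝓝 s] fun _ => 0 := by
      filter_upwards [Iio_mem_nhds (hs.trans_lt hε)] with z hz
      exact cutDeriv_eq_zero hε (le_of_lt hz)
    exact contDiffAt_const.congr_of_eventuallyEq this

theorem contDiff_primitive {a : ℝ → ℝ} (ha : ContDiff ℝ ∞ a) :
    ContDiff ℝ ∞ (fun t => ∫ s in (0 : ℝ)..t, a s) := by
  have hd : ∀ t, HasDerivAt (fun t => ∫ s in (0 : ℝ)..t, a s) (a t) t := fun t =>
    (ha.continuous.integral_hasStrictDerivAt 0 t).hasDerivAt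
  rw [contDiff_infty_iff_deriv]
  refine ⟨fun t => (hd t).differentiableAt, ?_⟩
  rw [funext fun t => (hd t).deriv]
  exact ha

theorem primitive_eq_zero {a : ℝ → ℝ} (hε : 0 < ε) (ha : ∀ s ≤ ε, a s = 0) {t : ℝ} (ht : t ≤ ε) :
    ∫ s in (0 : ℝ)..t, a s = 0 := by
  refine (intervalIntegral.integral_congr fun s hs => ?_).trans intervalIntegral.integral_zero
  exact ha s (hs.2.trans (max_le hε.le ht))

/-- Take for `φ` and `ψ` the primitives from `0` of `cutDeriv k ε` and of its square. Without the
cutoff they would be `t^k` and `k²/(2k-1) t^(2k-1)`. -/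
theorem exists_smooth_power_cutoff (hk : 1 ≤ k) (hε : 0 < ε) :
    ∃ φ ψ : ℝ → ℝ, ContDiff ℝ ∞ φ ∧ ContDiff ℝ ∞ ψ ∧ (∀ t ≤ ε, φ t = 0) ∧ (∀ t ≤ ε, ψ t = 0) ∧
      (∀ t, deriv ψ t = deriv φ t ^ 2) ∧ (∀ t, 0 ≤ t → 0 ≤ ψ t) ∧
      (∀ t, 0 ≤ t → ψ t ≤ k * t ^ (2 * k - 1)) ∧ (∀ t, 0 ≤ t → 0 ≤ φ t) ∧
      (∀ t, 0 ≤ t → φ t ≤ t ^ k) ∧ (∀ t, 2 * ε ≤ t → t ^ k - (2 * ε) ^ k ≤ φ t) := by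
  have ha := contDiff_cutDeriv (k := k) hε
  have ha2 : ContDiff ℝ ∞ fun s => cutDeriv k ε s ^ 2 := ha.pow 2
  have hd : ∀ (a : ℝ → ℝ), ContDiff ℝ ∞ a → ∀ t,
      deriv (fun t => ∫ s in (0 : ℝ)..t, a s) t = a t := fun a ha t =>
    (ha.continuous.integral_hasStrictDerivAt 0 t).hasDerivAt.deriv
  have hb : ∀ a b, IntervalIntegrable (fun s : ℝ => k * s ^ (k - 1)) volume a b :=
    fun a b => (intervalIntegral.intervalIntegrable_rpow' (by linarith)).const_mul k
  have hb2 : ∀ a b, IntervalIntegrable (fun s : ℝ => k ^ 2 * s ^ (2 * k - 2)) volume a b :=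
    fun a b => (intervalIntegral.intervalIntegrable_rpow' (by linarith)).const_mul (k ^ 2)
  have hB : ∀ a b : ℝ, ∫ s in a..b, k * s ^ (k - 1) = b ^ k - a ^ k := fun a b => by
    rw [intervalIntegral.integral_const_mul, integral_rpow (Or.inl (by linarith)),
      sub_add_cancel, mul_div_cancel₀ _ (by linarith)]
  refine ⟨fun t => ∫ s in (0 : ℝ)..t, cutDeriv k ε s, fun t => ∫ s in (0 : ℝ)..t, cutDeriv k ε s ^ 2,
    contDiff_primitive ha, contDiff_primitive ha2,
    fun t ht => primitive_eq_zero hε (fun s hs => cutDeriv_eq_zero hε hs) ht,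
    fun t ht => primitive_eq_zero hε (fun s hs => by rw [cutDeriv_eq_zero hε hs]; simp) ht,
    fun t => by rw [hd _ ha, hd _ ha2],
    fun t ht => intervalIntegral.integral_nonneg ht fun s _ => sq_nonneg _, fun t ht => ?_,
    fun t ht => intervalIntegral.integral_nonneg ht fun s hs => cutDeriv_nonneg hk hs.1,
    fun t ht => ?_, fun t ht => ?_⟩
  · have h1 : ∫ s in (0 : ℝ)..t, cutDeriv k ε s ^ 2 ≤ ∫ s in (0 : ℝ)..t, k ^ 2 * s ^ (2 * k - 2) := by
      refine intervalIntegral.integral_mono_on ht (ha2.continuous.intervalIntegrable _ _)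
        (hb2 _ _) fun s hs => ?_
      refine (pow_le_pow_left₀ (cutDeriv_nonneg hk hs.1) (cutDeriv_le hk hs.1) 2).trans_eq ?_
      rw [mul_pow, ← Real.rpow_natCast (s ^ (k - 1)), ← Real.rpow_mul hs.1]
      congr 2
      push_cast
      ring
    refine h1.trans ?_
    rw [intervalIntegral.integral_const_mul, integral_rpow (Or.inl (by linarith)),
      Real.zero_rpow (by linarith), show 2 * k - 2 + 1 = 2 * k - 1 by ring, sub_zero, mul_div_assoc',
      div_le_iff₀ (by linarith)]
    have := Real.rpow_nonneg ht (2 * k - 1)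
    -- This is `k² ≤ k(2k-1)`, that is, `k(k-1) ≥ 0`.
    nlinarith [mul_nonneg (mul_nonneg (show 0 ≤ k by linarith) (show 0 ≤ k - 1 by linarith)) this]
  · have h1 : ∫ s in (0 : ℝ)..t, cutDeriv k ε s ≤ ∫ s in (0 : ℝ)..t, k * s ^ (k - 1) :=
      intervalIntegral.integral_mono_on ht (ha.continuous.intervalIntegrable _ _)
        (hb _ _) fun s hs => cutDeriv_le hk hs.1
    rwa [hB, Real.zero_rpow (by linarith), sub_zero] at h1
  -- The cutoff is inactive beyond `2ε`, so only the contribution of `[0, 2ε]` can be lost.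
  · have h1 : ∫ s in (2 * ε)..t, cutDeriv k ε s = ∫ s in (2 * ε)..t, k * s ^ (k - 1) := by
      refine intervalIntegral.integral_congr fun s hs => cutDeriv_eq hε ?_
      rw [uIcc_of_le ht] at hs
      exact hs.1
    have h2 := intervalIntegral.integral_add_adjacent_intervals
      (ha.continuous.intervalIntegrable (μ := volume) 0 (2 * ε))
      (ha.continuous.intervalIntegrable (μ := volume) (2 * ε) t)
    have h3 : 0 ≤ ∫ s in (0 : ℝ)..(2 * ε), cutDeriv k ε s :=
      intervalIntegral.integral_nonneg (by linarith) fun s hs => cutDeriv_nonneg hk hs.1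
    rw [h1, hB] at h2
    linarith

end Cutoff

/-! ### Norm inequalities on a probability space and the iteration. -/

section Iteration

/-- The `L^q` norm `(∫ |h|^q)^{1/q}`. -/
noncomputable def lpNormReal {Y : Type*} [MeasurableSpace Y] (μ : Measure Y) (q : ℝ) (h : Y → ℝ) :
    ℝ := (∫ x, |h x| ^ q ∂μ) ^ (1 / q)

theorem continuous_abs_rpow {Y : Type*} [TopologicalSpace Y] {h : Y → ℝ} (hh : Continuous h) {q : ℝ} (hq : 0 ≤ q) :
    Continuous fun x => |h x| ^ q :=
  hh.abs.rpow_const fun _ => Or.inr hq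

variable {Y : Type*} [MeasurableSpace Y] {μ : Measure Y}

theorem lpNormReal_nonneg (q : ℝ) (h : Y → ℝ) : 0 ≤ lpNormReal μ q h :=
  Real.rpow_nonneg (integral_nonneg fun _ => Real.rpow_nonneg (abs_nonneg _) _) _

theorem lpNormReal_rpow_rpow {f : Y → ℝ} (hf0 : ∀ x, 0 ≤ f x) {k q : ℝ} (hk : 0 < k) :
    lpNormReal μ q (fun x => f x ^ k) = lpNormReal μ (q * k) f ^ k := by
  have h0 : 0 ≤ ∫ x, |f x| ^ (q * k) ∂μ :=
    integral_nonneg fun x => Real.rpow_nonneg (abs_nonneg _) _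
  rw [lpNormReal, lpNormReal, ← Real.rpow_mul h0]
  congr 1
  · refine integral_congr_ae (Eventually.of_forall fun x => ?_)
    beta_reduce
    rw [abs_of_nonneg (hf0 x), abs_of_nonneg (Real.rpow_nonneg (hf0 x) _), ← Real.rpow_mul (hf0 x),
      mul_comm]
  · field_simp

theorem lpNormReal_two_sq (h : Y → ℝ) : lpNormReal μ 2 h ^ 2 = ∫ x, |h x| ^ (2 : ℝ) ∂μ := by
  have h0 : 0 ≤ ∫ x, |h x| ^ (2 : ℝ) ∂μ :=
    integral_nonneg fun x => Real.rpow_nonneg (abs_nonneg _) _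
  rw [lpNormReal, ← Real.rpow_natCast, ← Real.rpow_mul h0]
  norm_num

theorem integral_abs_rpow_rpow (h : Y → ℝ) {p : ℝ} (hp : 0 < p) :
    (∫ x, (|h x| ^ (2 : ℝ)) ^ p ∂μ) ^ (1 / p) = lpNormReal μ (2 * p) h ^ 2 := by
  have h0 : 0 ≤ ∫ x, |h x| ^ (2 * p) ∂μ :=
    integral_nonneg fun x => Real.rpow_nonneg (abs_nonneg _) _
  rw [lpNormReal, ← Real.rpow_natCast, ← Real.rpow_mul h0]
  congr 1
  · exact integral_congr_ae (Eventually.of_forall fun x => (Real.rpow_mul (abs_nonneg _) _ _).symm)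
  · push_cast
    field_simp

variable [TopologicalSpace Y] [CompactSpace Y] [BorelSpace Y] [IsProbabilityMeasure μ]

theorem integrable_continuous {h : Y → ℝ} (hh : Continuous h) : Integrable h μ :=
  hh.integrable_of_hasCompactSupport (HasCompactSupport.of_compactSpace h)

theorem integral_mul_le_holder {u v : Y → ℝ} (hu : Continuous u) (hv : Continuous v)
    (hu0 : ∀ x, 0 ≤ u x) (hv0 : ∀ x, 0 ≤ v x) {p q : ℝ} (hpq : p.HolderConjugate q) :
    ∫ x, u x * v x ∂μ ≤ (∫ x, u x ^ p ∂μ) ^ (1 / p) * (∫ x, v x ^ q ∂μ) ^ (1 / q) :=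
  integral_mul_le_Lp_mul_Lq_of_nonneg hpq (Eventually.of_forall hu0) (Eventually.of_forall hv0)
    (hu.memLp_of_hasCompactSupport (HasCompactSupport.of_compactSpace u))
    (hv.memLp_of_hasCompactSupport (HasCompactSupport.of_compactSpace v))

theorem integral_abs_mul_sq_le {l h : Y → ℝ} (hl : Continuous l) (hh : Continuous h) {p p' : ℝ}
    (hpp' : p.HolderConjugate p') :
    ∫ x, |h x| ^ (2 : ℝ) * |l x| ∂μ ≤ lpNormReal μ p' l * lpNormReal μ (2 * p) h ^ 2 := by
  have := integral_mul_le_holder (μ := μ) (continuous_abs_rpow hh zero_le_two) hl.abs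
    (fun x => Real.rpow_nonneg (abs_nonneg _) _) (fun x => abs_nonneg _) hpp'
  rw [integral_abs_rpow_rpow h hpp'.pos, mul_comm] at this
  exact this

/-- Hölder against the constant `1`, whose norm is `1` since the total mass is `1`. -/
theorem lpNormReal_two_le {h : Y → ℝ} (hh : Continuous h) {p : ℝ} (hp : 1 < p) :
    lpNormReal μ 2 h ≤ lpNormReal μ (2 * p) h := by
  have h1 := integral_abs_mul_sq_le (μ := μ) (l := fun _ => 1) continuous_const hh
    (Real.HolderConjugate.conjExponent hp)
  have h2 : lpNormReal μ p.conjExponent (fun _ => (1 : ℝ)) = 1 := by simp [lpNormReal]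
  rw [h2] at h1
  simp only [abs_one, mul_one, one_mul] at h1
  rw [← lpNormReal_two_sq] at h1
  exact (sq_le_sq₀ (lpNormReal_nonneg _ _) (lpNormReal_nonneg _ _)).1 h1

theorem lpNormReal_mono {u v : Y → ℝ} (hu : Continuous u) (hv : Continuous v) {q : ℝ} (hq : 0 < q)
    (h : ∀ x, |u x| ≤ |v x|) : lpNormReal μ q u ≤ lpNormReal μ q v :=
  Real.rpow_le_rpow (integral_nonneg fun x => Real.rpow_nonneg (abs_nonneg _) _)
    (integral_mono (integrable_continuous (continuous_abs_rpow hu hq.le))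
      (integrable_continuous (continuous_abs_rpow hv hq.le))
      fun x => Real.rpow_le_rpow (abs_nonneg _) (h x) hq.le) (by positivity)

theorem tendsto_lpNormReal {u : ℕ → Y → ℝ} {v : Y → ℝ} (hu : ∀ m, Continuous (u m))
    (hv : Continuous v) {q : ℝ} (hq : 0 < q) (h : ∀ m x, |u m x| ≤ |v x|)
    (hlim : ∀ x, Tendsto (fun m => u m x) atTop (𝓝 (v x))) :
    Tendsto (fun m => lpNormReal μ q (u m)) atTop (𝓝 (lpNormReal μ q v)) := by
  refine Tendsto.rpow_const ?_ (Or.inr (by positivity))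
  refine tendsto_integral_of_dominated_convergence (fun x => |v x| ^ q)
    (fun m => (continuous_abs_rpow (hu m) hq.le).aestronglyMeasurable)
    (integrable_continuous (continuous_abs_rpow hv hq.le))
    (fun m => Eventually.of_forall fun x => ?_) (Eventually.of_forall fun x => ?_)
  · rw [Real.norm_of_nonneg (Real.rpow_nonneg (abs_nonneg _) _)]
    exact Real.rpow_le_rpow (abs_nonneg _) (h m x) hq.le
  · exact (hlim x).abs.rpow_const (Or.inr hq.le)

/-- If `|f x| > b > C`, the open set `{|f| > b}` has mass `θ > 0`, and Markov's inequality gives `b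
θ^(1/q) ≤ C`. Letting `q → ∞` yields `b ≤ C`, a contradiction. -/
theorem le_of_lpNormReal_le [μ.IsOpenPosMeasure] {f : Y → ℝ} (hf : Continuous f)
    {q : ℕ → ℝ} (hq0 : ∀ m, 0 < q m) (hq : Tendsto q atTop atTop) {C : ℝ}
    (hC : ∀ m, lpNormReal μ (q m) f ≤ C) (x : Y) : |f x| ≤ C := by
  have hC0 : 0 ≤ C := (lpNormReal_nonneg _ _).trans (hC 0)
  by_contra! hx
  obtain ⟨b, hCb, hbx⟩ := exists_between hx
  have hb0 : 0 < b := hC0.trans_lt hCb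
  have hVo : IsOpen {y | b < |f y|} := isOpen_lt continuous_const hf.abs
  set θ := μ.real {y | b < |f y|} with hθ
  have hθ0 : 0 < θ := ENNReal.toReal_pos (hVo.measure_pos μ ⟨x, hbx⟩).ne' (measure_ne_top _ _)
  have hlow : ∀ m, b * θ ^ (1 / q m) ≤ C := fun m => by
    refine le_trans ?_ (hC m)
    have h1 := mul_meas_ge_le_integral_of_nonneg (μ := μ) (f := fun y => |f y| ^ q m)
      (Eventually.of_forall fun y => Real.rpow_nonneg (abs_nonneg _) _)
      (integrable_continuous (continuous_abs_rpow hf (hq0 m).le)) (b ^ q m)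
    have h2 : θ ≤ μ.real {y | b ^ q m ≤ |f y| ^ q m} :=
      measureReal_mono fun y hy => Real.rpow_le_rpow hb0.le (le_of_lt hy) (hq0 m).le
    have h3 := (mul_le_mul_of_nonneg_left h2 (Real.rpow_nonneg hb0.le (q m))).trans h1
    have h4 := Real.rpow_le_rpow (by positivity) h3 (one_div_nonneg.2 (hq0 m).le)
    rwa [Real.mul_rpow (by positivity) hθ0.le, ← Real.rpow_mul hb0.le,
      mul_one_div_cancel (hq0 m).ne', Real.rpow_one] at h4
  have hlim : Tendsto (fun m => b * θ ^ (1 / q m)) atTop (𝓝 (b * θ ^ (0 : ℝ))) :=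
    (Tendsto.rpow tendsto_const_nhds (hq.const_div_atTop 1) (Or.inl hθ0.ne')).const_mul b
  rw [Real.rpow_zero, mul_one] at hlim
  exact hCb.not_ge (le_of_tendsto' hlim hlow)

/-- The choice `k = r^i` makes the exponents chain, since `2ν r^i = 2p r^(i+1)`. With `s = r^(-1/2)`
one has `√(r^i) = s^i r^i`, so the `r^i`-th root of the constant is at most `exp(S√Λ s^i)`. -/
theorem moser_iteration [μ.IsOpenPosMeasure] {f : Y → ℝ} (hf : Continuous f) (hf0 : ∀ x, 0 ≤ f x)
    {p ν S Λ : ℝ} (hp : 0 < p) (hpν : p < ν) (hS : 0 ≤ S) (hΛ : 0 ≤ Λ)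
    (H : ∀ k, 1 ≤ k → lpNormReal μ (2 * ν) (fun x => f x ^ k) ≤
      (1 + S * Real.sqrt (k * Λ)) * lpNormReal μ (2 * p) (fun x => f x ^ k)) (x : Y) :
    |f x| ≤ Real.exp (S * Real.sqrt (Λ * ν) / (Real.sqrt ν - Real.sqrt p)) *
      lpNormReal μ (2 * p) f := by
  set r := ν / p with hr
  have hν : 0 < ν := hp.trans hpν
  have hr1 : 1 < r := (one_lt_div hp).2 hpν
  have hr0 : 0 < r := by linarith
  set s := (Real.sqrt r)⁻¹ with hs
  have hsr : 1 < Real.sqrt r := by rw [Real.lt_sqrt zero_le_one]; simpa using hr1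
  have hs0 : 0 ≤ s := by positivity
  have hs1 : s < 1 := inv_lt_one_of_one_lt₀ hsr
  have hrν : ∀ i : ℕ, 2 * ν * r ^ i = 2 * p * r ^ (i + 1) := fun i => by
    rw [pow_succ, hr]; field_simp
  have step : ∀ i : ℕ, lpNormReal μ (2 * p * r ^ (i + 1)) f ≤
      Real.exp (S * Real.sqrt Λ * s ^ i) * lpNormReal μ (2 * p * r ^ i) f := by
    intro i
    have hk1 : 1 ≤ r ^ i := one_le_pow₀ hr1.le
    have hk0 : 0 < r ^ i := by positivity
    have h := H (r ^ i) hk1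
    rw [lpNormReal_rpow_rpow hf0 hk0, lpNormReal_rpow_rpow hf0 hk0, hrν] at h
    have hsq : S * Real.sqrt (r ^ i * Λ) = S * Real.sqrt Λ * s ^ i * r ^ i := by
      have h1 : Real.sqrt (r ^ i) = s ^ i * r ^ i := by
        rw [hs, inv_pow, Real.sqrt_eq_iff_mul_self_eq (by positivity) (by positivity)]
        have : Real.sqrt r ^ i * Real.sqrt r ^ i = r ^ i := by
          rw [← mul_pow, Real.mul_self_sqrt hr0.le]
        field_simp
        nlinarith [this]
      rw [Real.sqrt_mul hk0.le, h1]
      ring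
    -- Here `1 + x ≤ exp x` turns the product of the constants into a sum of exponents.
    have hexp : 1 + S * Real.sqrt (r ^ i * Λ) ≤ Real.exp (S * Real.sqrt Λ * s ^ i) ^ (r ^ i) := by
      rw [← Real.exp_mul, ← hsq, add_comm]
      exact Real.add_one_le_exp _
    have h2 := h.trans (mul_le_mul_of_nonneg_right hexp
      (Real.rpow_nonneg (lpNormReal_nonneg _ _) _))
    rw [← Real.mul_rpow (Real.exp_pos _).le (lpNormReal_nonneg _ _)] at h2
    exact (Real.rpow_le_rpow_iff (lpNormReal_nonneg _ _)
      (mul_nonneg (Real.exp_pos _).le (lpNormReal_nonneg _ _)) hk0).1 h2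
  have iter : ∀ m : ℕ, lpNormReal μ (2 * p * r ^ m) f ≤
      Real.exp (S * Real.sqrt Λ * ∑ i ∈ Finset.range m, s ^ i) * lpNormReal μ (2 * p) f := by
    intro m
    induction m with
    | zero => simp
    | succ m ih =>
      refine (step m).trans ((mul_le_mul_of_nonneg_left ih (Real.exp_pos _).le).trans_eq ?_)
      rw [← mul_assoc, ← Real.exp_add, Finset.sum_range_succ]
      congr 2
      ring
  refine le_of_lpNormReal_le (μ := μ) hf (q := fun m => 2 * p * r ^ m) (fun m => by positivity)
    ((tendsto_pow_atTop_atTop_of_one_lt hr1).const_mul_atTop (by positivity)) (fun m => ?_) x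
  refine (iter m).trans (mul_le_mul_of_nonneg_right (Real.exp_le_exp.2 ?_) (lpNormReal_nonneg _ _))
  have hgeom : ∑ i ∈ Finset.range m, s ^ i ≤ (1 - s)⁻¹ := by
    rw [← tsum_geometric_of_lt_one hs0 hs1]
    exact (summable_geometric_of_lt_one hs0 hs1).sum_le_tsum _ fun i _ => pow_nonneg hs0 i
  refine (mul_le_mul_of_nonneg_left hgeom (by positivity)).trans_eq ?_
  have hsp : 0 < Real.sqrt p := Real.sqrt_pos.2 hp
  have hsν : Real.sqrt p < Real.sqrt ν := Real.sqrt_lt_sqrt hp.le hpν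
  have hsν0 : 0 < Real.sqrt ν := hsp.trans hsν
  rw [hs, hr, Real.sqrt_div hν.le, Real.sqrt_mul hΛ, inv_div]
  have : 0 < Real.sqrt ν - Real.sqrt p := by linarith
  -- The geometric sum `(1 - s)⁻¹` with `s = √(p/ν)` produces the denominator of the final constant.
  have h3 : (1 - Real.sqrt p / Real.sqrt ν)⁻¹ = Real.sqrt ν / (Real.sqrt ν - Real.sqrt p) := by
    rw [← inv_div]; field_simp
  rw [h3]
  ring

end Iteration

/-! ### The energy estimate for `f` and the reverse Hölder inequality. -/

section Subsolution

variable {n : ℕ} {M : Type*} [TopologicalSpace M] [ChartedSpace (Model n) M]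
  {f : M → ℝ} {θ : ℝ → ℝ} {ε : ℝ}

theorem comp_eventuallyEq_zero (hf : Continuous f) (hθ0 : ∀ t ≤ ε, θ t = 0) {x : M}
    (hx : f x < ε) : θ ∘ f =ᶠ[𝓝 x] fun _ => 0 := by
  filter_upwards [(isOpen_lt hf continuous_const).mem_nhds hx] with z hz
  exact hθ0 _ (le_of_lt hz)

/-- The support lies in the closed set `{ε ≤ f}`; this is why the cutoffs vanish up to `ε` and not
just at `0`. -/
theorem tsupport_comp_subset (hf : Continuous f) (hε : 0 < ε) (hθ0 : ∀ t ≤ ε, θ t = 0) :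
    tsupport (θ ∘ f) ⊆ {x | 0 < f x} := by
  have h : tsupport (θ ∘ f) ⊆ {x | ε ≤ f x} :=
    closure_minimal (fun x hx => by
      by_contra h
      exact hx (hθ0 _ (not_le.1 h).le)) (isClosed_le continuous_const hf)
  exact h.trans fun x hx => hε.trans_le hx

theorem contMDiff_comp_cutoff (hf : Continuous f)
    (hfs : ContMDiffOn (𝓡 n) 𝓘(ℝ, ℝ) ∞ f {x | 0 < f x}) (hε : 0 < ε) (hθ : ContDiff ℝ ∞ θ)
    (hθ0 : ∀ t ≤ ε, θ t = 0) : ContMDiff (𝓡 n) 𝓘(ℝ, ℝ) ∞ (θ ∘ f) := by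
  intro x
  rcases lt_or_ge (f x) ε with hx | hx
  · exact contMDiffAt_const.congr_of_eventuallyEq (comp_eventuallyEq_zero hf hθ0 hx)
  · have hx' : 0 < f x := hε.trans_le hx
    exact hθ.contMDiff.contMDiffAt.comp x
      ((hfs x hx').contMDiffAt ((isOpen_lt continuous_const hf).mem_nhds hx'))

theorem dirDeriv_comp {x : M} (hfx : MDifferentiableAt (𝓡 n) 𝓘(ℝ, ℝ) f x)
    (hθ : ContDiff ℝ ∞ θ) (X : ∀ x : M, TangentSpace (𝓡 n) x) :
    dirDeriv (θ ∘ f) X x = deriv θ (f x) * dirDeriv f X x := by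
  have hd : DifferentiableAt ℝ θ (f x) := hθ.differentiable (by simp) _
  rw [dirDeriv, mfderiv_comp x hd.mdifferentiableAt hfx, mfderiv_eq_fderiv]
  have h : ∀ a : ℝ, fderiv ℝ θ (f x) a = deriv θ (f x) * a := fun a => by
    rw [fderiv_eq_deriv_mul, mul_comm]
  exact h _

variable [IsManifold (𝓡 n) ∞ M]

theorem gradNorm_sq (g : RiemMetric n M) (u : M → ℝ) (x : M) :
    gradNorm g u x ^ 2 = dirDeriv u (grad g u) x := by
  rw [gradNorm, Real.sq_sqrt, inner_grad]
  · rfl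
  · by_cases h : grad g u x = 0
    · rw [h]; simp
    · exact (g.pos x _ h).le

theorem dirDeriv_grad_comm (g : RiemMetric n M) (u v : M → ℝ) (x : M) :
    dirDeriv u (grad g v) x = dirDeriv v (grad g u) x := by
  simp only [dirDeriv]
  rw [← inner_grad g, ← inner_grad g, g.symm]

/-- By the chain rule both sides are `φ'(f)² |∇f|²` where `f > 0`; elsewhere both vanish. -/
theorem gradNorm_sq_comp (g : RiemMetric n M) (hf : Continuous f)
    (hfs : ContMDiffOn (𝓡 n) 𝓘(ℝ, ℝ) ∞ f {x | 0 < f x}) (hε : 0 < ε) {φ ψ : ℝ → ℝ}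
    (hφ : ContDiff ℝ ∞ φ) (hψ : ContDiff ℝ ∞ ψ) (hφ0 : ∀ t ≤ ε, φ t = 0)
    (hψ0 : ∀ t ≤ ε, ψ t = 0) (hd : ∀ t, deriv ψ t = deriv φ t ^ 2) (x : M) :
    gradNorm g (φ ∘ f) x ^ 2 = dirDeriv (ψ ∘ f) (grad g f) x := by
  rw [gradNorm_sq]
  by_cases hx : 0 < f x
  · have hfx : MDifferentiableAt (𝓡 n) 𝓘(ℝ, ℝ) f x :=
      ((hfs x hx).contMDiffAt ((isOpen_lt continuous_const hf).mem_nhds hx)).mdifferentiableAt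
        (by simp)
    rw [dirDeriv_comp hfx hφ, dirDeriv_comp hfx hψ, dirDeriv_grad_comm,
      dirDeriv_comp hfx hφ, hd]
    ring
  · rw [dirDeriv_eq_zero_of_notMem_tsupport fun h => hx (tsupport_comp_subset hf hε hφ0 h),
      dirDeriv_eq_zero_of_notMem_tsupport fun h => hx (tsupport_comp_subset hf hε hψ0 h)]

variable [MeasurableSpace M]

/-- The Riemannian volume, normalized to total mass `1`. -/
noncomputable def normalizedVol (g : RiemMetric n M) : Measure M := (vol g univ)⁻¹ • vol g

theorem avgNorm_eq_lpNormReal (g : RiemMetric n M) (q : ℝ) (h : M → ℝ) :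
    avgNorm g q h = lpNormReal (normalizedVol g) q h := by
  rw [avgNorm, lpNormReal, normalizedVol, integral_smul_measure, ENNReal.toReal_inv, smul_eq_mul]
  rfl

variable [BorelSpace M] [T2Space M] [CompactSpace M]

theorem isProbabilityMeasure_normalizedVol [Nonempty M] (g : RiemMetric n M) :
    IsProbabilityMeasure (normalizedVol g) := by
  have := isFiniteMeasure_vol g
  have := isOpenPosMeasure_vol g
  refine ⟨?_⟩
  rw [normalizedVol, Measure.smul_apply, smul_eq_mul]
  exact ENNReal.inv_mul_cancel (isOpen_univ.measure_pos _ univ_nonempty).ne' (measure_ne_top _ _)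

theorem isOpenPosMeasure_normalizedVol (g : RiemMetric n M) :
    (normalizedVol g).IsOpenPosMeasure := by
  have := isFiniteMeasure_vol g
  have := isOpenPosMeasure_vol g
  refine ⟨fun U hU hne h => ?_⟩
  rw [normalizedVol, Measure.smul_apply, smul_eq_mul, mul_eq_zero] at h
  rcases h with h | h
  · exact measure_ne_top _ _ (ENNReal.inv_eq_zero.1 h)
  · exact (hU.measure_pos _ hne).ne' h

/-- The energy estimate: Green's formula with test function `ψ∘f` and field `∇f`, then the
differential inequality, then Hölder. The bound does not depend on `ε`. -/
theorem lpNormReal_gradNorm_le [Nonempty M] (g : RiemMetric n M) {lam : M → ℝ}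
    (hf : Continuous f) (hf0 : ∀ x, 0 ≤ f x)
    (hfs : ContMDiffOn (𝓡 n) 𝓘(ℝ, ℝ) ∞ f {x | 0 < f x}) (hlam : Continuous lam)
    (hf_lap : ∀ x, 0 < f x → -lam x * f x ≤ laplacian g f x) {p p' k : ℝ}
    (hpp' : p.HolderConjugate p') (hk : 1 ≤ k) (hε : 0 < ε) {φ ψ : ℝ → ℝ}
    (hφ : ContDiff ℝ ∞ φ) (hψ : ContDiff ℝ ∞ ψ) (hφ0 : ∀ t ≤ ε, φ t = 0)
    (hψ0 : ∀ t ≤ ε, ψ t = 0) (hd : ∀ t, deriv ψ t = deriv φ t ^ 2)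
    (hψn : ∀ t, 0 ≤ t → 0 ≤ ψ t) (hψk : ∀ t, 0 ≤ t → ψ t ≤ k * t ^ (2 * k - 1)) :
    lpNormReal (normalizedVol g) 2 (gradNorm g (φ ∘ f)) ≤
      Real.sqrt (k * lpNormReal (normalizedVol g) p' lam) *
        lpNormReal (normalizedVol g) (2 * p) (fun x => f x ^ k) := by
  have := isProbabilityMeasure_normalizedVol g
  have hU : IsOpen {x | 0 < f x} := isOpen_lt continuous_const hf
  have hX : SmoothCoordsOn (grad g f) {x | 0 < f x} := fun c i =>
    contDiffOn_vecCoord_grad g c hU hfs i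
  have hv := contMDiff_comp_cutoff hf hfs hε hψ hψ0
  have hvs := tsupport_comp_subset hf hε hψ0
  have hfk : Continuous fun x => f x ^ k := hf.rpow_const fun _ => Or.inr (by linarith)
  have hΛ : 0 ≤ lpNormReal (normalizedVol g) p' lam := lpNormReal_nonneg _ _
  have hgreen : ∫ x, (ψ ∘ f) x * laplacian g f x ∂(normalizedVol g) =
      -∫ x, dirDeriv (ψ ∘ f) (grad g f) x ∂(normalizedVol g) := by
    rw [normalizedVol, integral_smul_measure, integral_smul_measure, ← smul_neg]
    congr 1
    exact integral_mul_divergence g hU hX hv hvs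
  have hcont : Continuous fun x => (ψ ∘ f) x * laplacian g f x :=
    continuous_mul_of_tsupport_subset hU hv.continuous hvs (continuousOn_divergence g hU hX)
  have hpt : ∀ x, -((ψ ∘ f) x * laplacian g f x) ≤ k * (|f x ^ k| ^ (2 : ℝ) * |lam x|) := by
    intro x
    rcases (hf0 x).eq_or_lt with h0 | h0
    · have : (ψ ∘ f) x = 0 := hψ0 _ (by rw [← h0]; exact hε.le)
      rw [this, zero_mul, neg_zero]
      positivity
    · have hψx : 0 ≤ ψ (f x) := hψn _ h0.le
      have h1 : -((ψ ∘ f) x * laplacian g f x) ≤ ψ (f x) * (|lam x| * f x) := by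
        rw [Function.comp_apply, ← mul_neg]
        refine mul_le_mul_of_nonneg_left ?_ hψx
        have := hf_lap x h0
        have := mul_le_mul_of_nonneg_right (le_abs_self (lam x)) h0.le
        linarith
      -- The bound on `ψ` supplies `k f^(2k-1)`, and the factor `f` from the inequality completes it
      -- to `k f^(2k)`.
      refine h1.trans ((mul_le_mul_of_nonneg_right (hψk _ h0.le) (by positivity)).trans_eq ?_)
      rw [abs_of_nonneg (Real.rpow_nonneg h0.le _), ← Real.rpow_mul h0.le,
        show k * 2 = 2 * k - 1 + 1 by ring, Real.rpow_add h0, Real.rpow_one]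
      ring
  have hsq : lpNormReal (normalizedVol g) 2 (gradNorm g (φ ∘ f)) ^ 2 ≤
      k * (lpNormReal (normalizedVol g) p' lam *
        lpNormReal (normalizedVol g) (2 * p) (fun x => f x ^ k) ^ 2) := by
    calc lpNormReal (normalizedVol g) 2 (gradNorm g (φ ∘ f)) ^ 2
        = ∫ x, dirDeriv (ψ ∘ f) (grad g f) x ∂(normalizedVol g) := by
          rw [lpNormReal_two_sq]
          refine integral_congr_ae (Eventually.of_forall fun x => ?_)
          beta_reduce
          rw [Real.rpow_two, sq_abs, gradNorm_sq_comp g hf hfs hε hφ hψ hφ0 hψ0 hd]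
      _ = ∫ x, -((ψ ∘ f) x * laplacian g f x) ∂(normalizedVol g) := by
          rw [integral_neg, hgreen, neg_neg]
      _ ≤ ∫ x, k * (|f x ^ k| ^ (2 : ℝ) * |lam x|) ∂(normalizedVol g) :=
          integral_mono (integrable_continuous hcont.neg) (integrable_continuous
            (((continuous_abs_rpow hfk zero_le_two).mul hlam.abs).const_mul k)) hpt
      _ ≤ _ := by
          rw [integral_const_mul]
          exact mul_le_mul_of_nonneg_left (integral_abs_mul_sq_le hlam hfk hpp') (by linarith)
  refine (sq_le_sq₀ (lpNormReal_nonneg _ _)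
    (mul_nonneg (Real.sqrt_nonneg _) (lpNormReal_nonneg _ _))).1 (hsq.trans_eq ?_)
  rw [mul_pow, Real.sq_sqrt (mul_nonneg (by linarith) hΛ)]
  ring

/-- Sobolev applies to the smooth functions `φ_m∘f` with `ε = 1/(m+1)`. They increase to nothing
larger than `f^k` and converge to it pointwise, so the left side passes to the limit by dominated
convergence, while the right side is bounded uniformly in `m`. -/
theorem lpNormReal_rpow_le_of_sobolev [Nonempty M] (g : RiemMetric n M) {ν S : ℝ} (hS : 0 ≤ S)
    (hSobolev : ∀ u : M → ℝ, ContMDiff (𝓡 n) 𝓘(ℝ, ℝ) ∞ u →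
      avgNorm g (2 * ν) u ≤ S * avgNorm g 2 (gradNorm g u) + avgNorm g 2 u)
    {lam : M → ℝ} (hf : Continuous f) (hf0 : ∀ x, 0 ≤ f x)
    (hfs : ContMDiffOn (𝓡 n) 𝓘(ℝ, ℝ) ∞ f {x | 0 < f x}) (hlam : Continuous lam)
    (hf_lap : ∀ x, 0 < f x → -lam x * f x ≤ laplacian g f x) {p p' k : ℝ} (hν : 0 < ν)
    (hpp' : p.HolderConjugate p') (hk : 1 ≤ k) :
    lpNormReal (normalizedVol g) (2 * ν) (fun x => f x ^ k) ≤
      (1 + S * Real.sqrt (k * lpNormReal (normalizedVol g) p' lam)) *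
        lpNormReal (normalizedVol g) (2 * p) (fun x => f x ^ k) := by
  have := isProbabilityMeasure_normalizedVol g
  simp only [avgNorm_eq_lpNormReal] at hSobolev
  have hfk : Continuous fun x => f x ^ k := hf.rpow_const fun _ => Or.inr (by linarith)
  have hε : ∀ m : ℕ, 0 < 1 / ((m : ℝ) + 1) := fun m => by positivity
  choose φ ψ hφ hψ hφ0 hψ0 hd hψn hψk hφn hφk hφl using
    fun m => exists_smooth_power_cutoff hk (hε m)
  have hu : ∀ m, ContMDiff (𝓡 n) 𝓘(ℝ, ℝ) ∞ (φ m ∘ f) := fun m =>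
    contMDiff_comp_cutoff hf hfs (hε m) (hφ m) (hφ0 m)
  have habs : ∀ m x, |(φ m ∘ f) x| ≤ |f x ^ k| := fun m x => by
    rw [Function.comp_apply, abs_of_nonneg (hφn m _ (hf0 x)),
      abs_of_nonneg (Real.rpow_nonneg (hf0 x) _)]
    exact hφk m _ (hf0 x)
  have hlim : ∀ x, Tendsto (fun m => (φ m ∘ f) x) atTop (𝓝 (f x ^ k)) := fun x => by
    have hε0 : Tendsto (fun m : ℕ => 2 * (1 / ((m : ℝ) + 1))) atTop (𝓝 0) := by
      simpa using tendsto_one_div_add_atTop_nhds_zero_nat.const_mul (2 : ℝ)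
    rcases (hf0 x).eq_or_lt with h0 | h0
    · have : ∀ m, (φ m ∘ f) x = f x ^ k := fun m => by
        rw [Function.comp_apply, ← h0, hφ0 m 0 (hε m).le, Real.zero_rpow (by linarith)]
      simp only [this]
      exact tendsto_const_nhds
    · have h1 : Tendsto (fun m : ℕ => f x ^ k - (2 * (1 / ((m : ℝ) + 1))) ^ k) atTop
          (𝓝 (f x ^ k)) := by
        have := (hε0.rpow_const (Or.inr (show 0 ≤ k by linarith))).const_sub (f x ^ k)
        rwa [Real.zero_rpow (by linarith), sub_zero] at this
      refine tendsto_of_tendsto_of_tendsto_of_le_of_le' h1 tendsto_const_nhds ?_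
        (Eventually.of_forall fun m => hφk m _ (hf0 x))
      filter_upwards [hε0.eventually_le_const h0] with m hm
      exact hφl m _ hm
  refine le_of_tendsto' (tendsto_lpNormReal (fun m => (hu m).continuous) hfk
    (show 0 < 2 * ν by linarith) habs hlim) fun m => ?_
  refine (hSobolev _ (hu m)).trans ?_
  have h1 := lpNormReal_gradNorm_le g hf hf0 hfs hlam hf_lap hpp' hk (hε m) (hφ m) (hψ m) (hφ0 m)
    (hψ0 m) (hd m) (hψn m) (hψk m)
  have h2 := (lpNormReal_mono (μ := normalizedVol g) (hu m).continuous hfk zero_lt_two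
    (habs m)).trans (lpNormReal_two_le hfk hpp'.lt)
  have h3 := mul_le_mul_of_nonneg_left h1 hS
  linarith

end Subsolution

end RiemannianGeometry

open RiemannianGeometry in
theorem lemma2p1 {n : ℕ} {M : Type*} [TopologicalSpace M] [T2Space M] [CompactSpace M] [Nonempty M]
    [ChartedSpace (Model n) M] [IsManifold (𝓡 n) ∞ M] [MeasurableSpace M] [BorelSpace M]
    (g : RiemMetric n M) (ν S : ℝ) (hν : 1 < ν) (hS : 0 ≤ S)
    (hSobolev : ∀ u : M → ℝ, ContMDiff (𝓡 n) 𝓘(ℝ, ℝ) ∞ u →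
      avgNorm g (2 * ν) u ≤ S * avgNorm g 2 (gradNorm g u) + avgNorm g 2 u)
    (f lam : M → ℝ) (hf_nonneg : ∀ x, 0 ≤ f x) (hf_cont : Continuous f)
    (hf_smooth : ContMDiffOn (𝓡 n) 𝓘(ℝ, ℝ) ∞ f {x | 0 < f x})
    (hlam : Continuous lam)
    (hf_lap : ∀ x, 0 < f x → -lam x * f x ≤ laplacian g f x)
    (p p' : ℝ) (hp : p ∈ Set.Ioo 1 ν) (hpp' : 1 / p + 1 / p' = 1) :
    supNorm f ≤
      Real.exp (S * Real.sqrt (avgNorm g p' lam * ν) / (Real.sqrt ν - Real.sqrt p)) *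
        avgNorm g (2 * p) f := by
  have := isProbabilityMeasure_normalizedVol g
  have := isOpenPosMeasure_normalizedVol g
  have hconj : p.HolderConjugate p' :=
    Real.holderConjugate_iff.2 ⟨hp.1, by simpa only [one_div] using hpp'⟩
  rw [avgNorm_eq_lpNormReal, avgNorm_eq_lpNormReal]
  exact ciSup_le fun x => moser_iteration hf_cont hf_nonneg (by linarith [hp.1]) hp.2 hS
    (lpNormReal_nonneg _ _) (fun k hk => lpNormReal_rpow_le_of_sobolev g hS hSobolev hf_cont
      hf_nonneg hf_smooth hlam hf_lap (by linarith) hconj hk) x
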